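/- Let $H\in L_2(\mathbb R)$ be real-valued, with Fourier--Plancherel transform $H^*(\lambda)=\int_{-\infty}^{\infty}e^{-i\lambda t}H(t)\,dt$. Let $W$ be a standard Wiener process on $\mathbb R$ and let $Y(t)=\int_{-\infty}^{\infty}H(t-s)\,dW(s)$, $t\in\mathbb R$ (a mean-square stochastic integral); suppose that $Y$ is a.s. sample continuous on $\mathbb R$. Let $Z=(Z(\tau),\tau\in\mathbb R)$ be a separable real-valued zero-mean Gaussian process with covariance function $$\mathbf E\,Z(\tau_1)Z(\tau_2)=\frac1{2\pi}\int_{-\infty}^{\infty}\Big[e^{i(\tau_1-\tau_2)\lambda}|H^*(\lambda)|^2+e^{i(\tau_1+\tau_2)\lambda}(H^*(\lambda))^2\Big]d\lambda,\qquad \tau_1,\tau_2\in\mathbb R.$$ Let $\xi\sim N(0,1)$ be independent of the process $Y$, let $[a,b]\subset\mathbb R$ with $a\le b$, and let $b(\tau)\ge 0$, $\tau\in[a,b]$, be defined by $$b^2(\tau)=\sup_{u\in[a,b]}\max\Big(0,\ \mathbf E(\sqrt2\,Y(u))^2-\mathbf E Z^2(u)\Big)-\Big(\mathbf E(\sqrt2\,Y(\tau))^2-\mathbf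 E Z^2(\tau)\Big).$$ Then $$b^2(\tau)=\int_{-\infty}^{\infty}H(2\tau-s)H(s)\,ds-\inf_{u\in[a,b]}\int_{-\infty}^{\infty}H(2u-s)H(s)\,ds,\qquad \tau\in[a,b],$$ and, for every $x>0$, $$\mathbf P\Big\{\sup_{\tau\in[a,b]}|Z(\tau)|>x\Big\}\le 2\,\mathbf P\Big\{\sup_{\tau\in[a,b]}\big(\sqrt2\,Y(\tau)+\xi\, b(\tau)\big)>x\Big\}.$$ -/

import Mathlib

open MeasureTheory ProbabilityTheory Set Filter Topology
open scoped FourierTransform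

noncomputable section

namespace CrossCorrelogram

/-- The Fourier-Plancherel transform `H*` of a real-valued `H ∈ L₂(ℝ)`, in the normalisation
`H*(l) = ∫ exp(-i l t) H(t) dt`. Mathlib's transform on `L₂` uses `exp(-2 π i v t)`,
whence the rescaling of the argument. -/
def plancherel (H : ℝ → ℝ) (hH : MemLp H 2 volume) (l : ℝ) : ℂ :=
  (𝓕 (MemLp.toLp (fun t => (H t : ℂ)) hH.ofReal : Lp ℂ 2 (volume : Measure ℝ)) :
    Lp ℂ 2 (volume : Measure ℝ)) (l / (2 * Real.pi))

/-- The limiting covariance function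
`C(s, t) = (1 / 2π) ∫ [exp(i (s - t) l) |H*(l)|² + exp(i (s + t) l) (H*(l))²] dl`. -/
def limitCov (H : ℝ → ℝ) (hH : MemLp H 2 volume) (s t : ℝ) : ℂ :=
  (1 / (2 * (Real.pi : ℂ))) * ∫ l : ℝ,
    (Complex.exp (Complex.I * ((s - t : ℝ) : ℂ) * (l : ℂ)) * ((‖plancherel H hH l‖ ^ 2 : ℝ) : ℂ)
      + Complex.exp (Complex.I * ((s + t : ℝ) : ℂ) * (l : ℂ)) * (plancherel H hH l) ^ 2)

/-- The autoconvolution of `H` at `2 t`: `∫ H(2 t - s) H(s) ds`. -/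
def autoconv (H : ℝ → ℝ) (t : ℝ) : ℝ := ∫ s : ℝ, H (2 * t - s) * H s

section Paths

variable {Ω : Type*} [MeasurableSpace Ω]

/-- A standard (two-sided) Wiener process on `ℝ`: a centred Gaussian process with
covariance `(|s| + |t| - |s - t|) / 2` (so that `W 0 = 0` a.s. and the variance of an increment
is the length of the interval) and a.s. continuous paths. -/
structure IsWienerProcess (W : ℝ → Ω → ℝ) (P : Measure Ω) : Prop where
  gaussian : IsGaussianProcess W P
  mean_zero : ∀ t, ∫ ω, W t ω ∂P = 0
  cov_eq : ∀ s t, ∫ ω, W s ω * W t ω ∂P = (|s| + |t| - |s - t|) / 2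
  continuous_paths : ∀ᵐ ω ∂P, Continuous fun t => W t ω

/-- A real step function `∑ i, c i • 1_{(l i, r i]}` on the line, given by its data. -/
structure StepFun where
  n : ℕ
  c : Fin n → ℝ
  l : Fin n → ℝ
  r : Fin n → ℝ
  le : ∀ i, l i ≤ r i

/-- The value of a step function. -/
def StepFun.eval (φ : StepFun) (s : ℝ) : ℝ :=
  ∑ i, (Ioc (φ.l i) (φ.r i)).indicator (fun _ => φ.c i) s

/-- The stochastic integral of a step function: `∑ i, c i * (W (r i) - W (l i))`. -/
def StepFun.integral (φ : StepFun) (W : ℝ → Ω → ℝ) (ω : Ω) : ℝ :=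
  ∑ i, φ.c i * (W (φ.r i) ω - W (φ.l i) ω)

/-- `J` is (a version of) the Wiener integral `∫ f(s) dW(s)` of `f ∈ L₂(ℝ)`: it is the
mean-square limit of the integrals of step functions that converge to `f` in `L₂(ℝ)`. -/
def IsWienerIntegral (W : ℝ → Ω → ℝ) (P : Measure Ω) (f : ℝ → ℝ) (J : Ω → ℝ) : Prop :=
  MemLp f 2 volume ∧ MemLp J 2 P ∧ ∃ φ : ℕ → StepFun,
    Tendsto (fun k => eLpNorm (fun s => f s - (φ k).eval s) 2 volume) atTop (𝓝 0) ∧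
    Tendsto (fun k => eLpNorm (fun ω => J ω - (φ k).integral W ω) 2 P) atTop (𝓝 0)

/-- Separability of a real process indexed by `ℝ` (in the sense of Doob): for some
countable set `D` and outside some null set, a path that stays in a closed set `F` along
`D ∩ U`, with `U` open, stays in `F` along `U`. -/
def IsSeparableProcess (X : ℝ → Ω → ℝ) (P : Measure Ω) : Prop :=
  ∃ D : Set ℝ, D.Countable ∧ ∀ᵐ ω ∂P, ∀ U F : Set ℝ, IsOpen U → IsClosed F →
    (∀ t ∈ D ∩ U, X t ω ∈ F) → ∀ t ∈ U, X t ω ∈ F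

/-- The supremum, in the extended reals, of `X t` over `t ∈ [a, b]`. -/
def supOn (a b : ℝ) (X : ℝ → ℝ) : EReal := ⨆ t ∈ Icc a b, (X t : EReal)

variable {Ω' : Type*} [MeasurableSpace Ω']

/-- The difference of variances `E (√2 Y(t))² - E Z(t)²`. -/
def varGap (Y : ℝ → Ω → ℝ) (P : Measure Ω) (Z : ℝ → Ω' → ℝ) (P' : Measure Ω') (t : ℝ) : ℝ :=
  (∫ ω, (√2 * Y t ω) ^ 2 ∂P) - ∫ ω, (Z t ω) ^ 2 ∂P'

/-- The variance-correction function `b` on `[lo, hi]`, the nonnegative root of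
`b²(t) = sup_{u ∈ [lo, hi]} max (0, E (√2 Y(u))² - E Z(u)²) - (E (√2 Y(t))² - E Z(t)²)`. -/
def corr (Y : ℝ → Ω → ℝ) (P : Measure Ω) (Z : ℝ → Ω' → ℝ) (P' : Measure Ω')
    (lo hi t : ℝ) : ℝ :=
  √(sSup ((fun u => max 0 (varGap Y P Z P' u)) '' Icc lo hi) - varGap Y P Z P' t)

end Paths

end CrossCorrelogram

end

/-! Write `R(s, t) = ∫ H(s - u) H(t - u) du` and `Q(s, t) = ∫ H(s - u) H(t + u) du`. By Plancherel,
`Z` has covariance `R + Q` (`limitCov_eq`). By the Itô isometry, `√2 Y + ξ β` has covariance `2R +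
ββᵀ`, and the difference is `(R - Q) + ββᵀ`. For `F = ∑ cᵢ H(τᵢ - ·)` the forms of `R` and `Q` are
`∫ F(u)² du` and `∫ F(u) F(-u) du`, and the second is at most the first in absolute value
(`integral_mul_neg_le`). Hence both `R + Q` and the difference are positive semidefinite, whatever
the vector `β`.

A Gaussian vector with the larger covariance is distributed as one with the smaller covariance plus
independent Gaussian noise. By Anderson's inequality (`PrekopaLeindler.measure_add_mem_le`) such
noise can only lower the probability of staying in the cube `|yᵢ| ≤ x`. So the maximum of `|Z|` over
finitely many times is stochastically dominated by that of `|√2 Y + ξ β|`; a union bound and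
symmetry remove the absolute value at the cost of the factor 2 (`measure_exists_abs_gt_le`).
Separability of `Z` extends this to `[a, b]`. Anderson's inequality is derived here from
Prékopa-Leindler, which passes from the line to products and linear images.

The formula for `b²` is the diagonal case: the variance gap at `t` is `∫ H² - Q(t, t)`, and `Q(t,
t)` is the autoconvolution at `2t`. -/

noncomputable section

namespace CrossCorrelogram

open scoped ENNReal MatrixOrder Matrix ComplexConjugate

/-! ### Prékopa-Leindler for Gaussian measures, and Anderson's inequality -/

section PrekopaLeindler

/-- One-dimensional Brunn-Minkowski inequality, for midpoints of two compact sets. -/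
lemma volume_add_volume_le_of_isCompact {K L C : Set ℝ} (hK : IsCompact K) (hL : IsCompact L)
    (hKn : K.Nonempty) (hLn : L.Nonempty) (hC : ∀ x ∈ K, ∀ y ∈ L, (x + y) / 2 ∈ C) :
    volume K + volume L ≤ 2 * volume C := by
  obtain ⟨M, hMK, hM⟩ := hK.exists_isGreatest hKn
  obtain ⟨m, hmL, hm⟩ := hL.exists_isLeast hLn
  have hscale : volume ((fun z : ℝ => (1 / 2 : ℝ) * z) ⁻¹' C) = 2 * volume C := by
    rw [Real.volume_preimage_mul_left (by norm_num)]
    norm_num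
  rw [← hscale]
  set C' := (fun z : ℝ => (1 / 2 : ℝ) * z) ⁻¹' C
  -- `C'` contains `K + m` and `M + L`, where `M = max K` and `m = min L`. The first lies to the
  -- left of `M + m` and the second to the right, so they meet only in that point.
  rw [← measure_inter_add_sdiff C' (measurableSet_Iio (a := M + m))]
  refine add_le_add ?_ ?_
  · calc volume K = volume (K \ {M}) := (measure_sdiff_null (by simp)).symm
      _ = volume ((fun z => z + m) '' (K \ {M})) := by
          rw [image_add_right, measure_preimage_add_right]
      _ ≤ _ := by
          refine measure_mono ?_
          rintro _ ⟨z, ⟨hz, hzM⟩, rfl⟩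
          refine ⟨?_, ?_⟩
          · have := hC z hz m hmL
            simp only [C', mem_preimage]
            convert this using 1
            ring
          · have := lt_of_le_of_ne (hM hz) hzM
            simp only [mem_Iio]
            linarith
  · calc volume L = volume ((fun z => M + z) '' L) := by
          rw [image_add_left, measure_preimage_add]
      _ ≤ _ := by
          refine measure_mono ?_
          rintro _ ⟨z, hz, rfl⟩
          refine ⟨?_, ?_⟩
          · have := hC M hMK z hz
            simp only [C', mem_preimage]
            convert this using 1
            ring
          · have := hm hz
            simp only [mem_Iio, not_lt]
            linarith

/-- One-dimensional Brunn-Minkowski inequality, for midpoints of two measurable sets. -/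
lemma volume_add_volume_le {A B C : Set ℝ} (hA : MeasurableSet A) (hB : MeasurableSet B)
    (hAn : A.Nonempty) (hBn : B.Nonempty) (hC : ∀ x ∈ A, ∀ y ∈ B, (x + y) / 2 ∈ C) :
    volume A + volume B ≤ 2 * volume C := by
  obtain ⟨a, ha⟩ := hAn
  obtain ⟨b, hb⟩ := hBn
  rw [hA.measure_eq_iSup_isCompact, hB.measure_eq_iSup_isCompact]
  simp only [iSup_and']
  have key : ∀ K L : Set ℝ, K ⊆ A → IsCompact K → L ⊆ B → IsCompact L →
      volume K + volume L ≤ 2 * volume C := by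
    intro K L hKA hK hLB hL
    -- Adjoining `a` and `b` keeps the sets compact and makes them nonempty.
    calc volume K + volume L ≤ volume (insert a K) + volume (insert b L) := by
          gcongr <;> exact subset_insert _ _
      _ ≤ _ := by
        refine volume_add_volume_le_of_isCompact (hK.insert a) (hL.insert b) ⟨a, by simp⟩
          ⟨b, by simp⟩ fun x hx y hy => hC x ?_ y ?_
        · exact insert_subset ha hKA hx
        · exact insert_subset hb hLB hy
  refine ENNReal.biSup_add_biSup_le' (p := fun K => K ⊆ A ∧ IsCompact K)
    (q := fun L => L ⊆ B ∧ IsCompact L) ⟨∅, by simp⟩ ⟨∅, by simp⟩ ?_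
  rintro K ⟨h1, h2⟩ L ⟨h3, h4⟩
  exact key K L h1 h2 h3 h4

/-- Layer-cake formula: midpoints of `{f > t}` and `{g > t}` lie in `{h > t}`, so Brunn-Minkowski
applies at each level. The common supremum 1 is essential: it makes the two superlevel sets nonempty
for the same `t`, and both are empty from 1 on. -/
lemma lintegral_add_le_of_sup_eq_one {f g h : ℝ → ℝ} (hf : Measurable f) (hg : Measurable g)
    (hh : Measurable h) (f0 : ∀ x, 0 ≤ f x) (g0 : ∀ x, 0 ≤ g x) (h0 : ∀ x, 0 ≤ h x)
    (f1 : ∀ x, f x ≤ 1) (g1 : ∀ x, g x ≤ 1) (fs : ∀ t < 1, ∃ x, t < f x)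
    (gs : ∀ t < 1, ∃ x, t < g x) (hfgh : ∀ x y, f x * g y ≤ h ((x + y) / 2) ^ 2) :
    (∫⁻ x, ENNReal.ofReal (f x)) + (∫⁻ x, ENNReal.ofReal (g x)) ≤
      2 * ∫⁻ x, ENNReal.ofReal (h x) := by
  rw [lintegral_eq_lintegral_meas_lt _ (ae_of_all _ f0) hf.aemeasurable,
    lintegral_eq_lintegral_meas_lt _ (ae_of_all _ g0) hg.aemeasurable,
    lintegral_eq_lintegral_meas_lt _ (ae_of_all _ h0) hh.aemeasurable]
  have anti : Antitone fun t => volume {x | t < f x} := fun s t hst =>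
    measure_mono fun x hx => lt_of_le_of_lt hst hx
  rw [← lintegral_add_left anti.measurable, ← lintegral_const_mul' _ _ (by simp)]
  refine setLIntegral_mono' measurableSet_Ioi fun t ht => ?_
  by_cases ht1 : t < 1
  · refine volume_add_volume_le (measurableSet_lt measurable_const hf)
      (measurableSet_lt measurable_const hg) (fs t ht1) (gs t ht1) ?_
    intro x hx y hy
    simp only [mem_ofPred_eq, mem_Ioi] at hx hy ht ⊢
    refine lt_of_pow_lt_pow_left₀ 2 (h0 _) (lt_of_lt_of_le ?_ (hfgh x y))
    nlinarith
  · have e1 : {x | t < f x} = ∅ := by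
      ext x; simp only [mem_ofPred_eq, mem_empty_iff_false, iff_false, not_lt]
      linarith [f1 x]
    have e2 : {x | t < g x} = ∅ := by
      ext x; simp only [mem_ofPred_eq, mem_empty_iff_false, iff_false, not_lt]
      linarith [g1 x]
    simp [e1, e2]

lemma mul_le_sq_of_add_le_two_mul {a b c : ℝ≥0∞} (h : a + b ≤ 2 * c) : a * b ≤ c ^ 2 := by
  rcases eq_or_ne c ⊤ with rfl | hc
  · simp
  have hab : a + b ≠ ⊤ := ne_top_of_le_ne_top (ENNReal.mul_ne_top (by simp) hc) h
  rw [Ne, ENNReal.add_eq_top, not_or] at hab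
  lift a to NNReal using hab.1
  lift b to NNReal using hab.2
  lift c to NNReal using hc
  norm_cast at h ⊢
  rw [← NNReal.coe_le_coe] at h ⊢
  push_cast at h ⊢
  nlinarith [sq_nonneg ((a : ℝ) - b), a.2, b.2, c.2]

/-- The one-dimensional Prékopa-Leindler inequality for Lebesgue measure. -/
lemma lintegral_mul_lintegral_le_sq {f g h : ℝ → ℝ} (hf : Measurable f) (hg : Measurable g)
    (hh : Measurable h) (f0 : ∀ x, 0 ≤ f x) (g0 : ∀ x, 0 ≤ g x) (h0 : ∀ x, 0 ≤ h x)
    (fb : BddAbove (range f)) (gb : BddAbove (range g))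
    (hfgh : ∀ x y, f x * g y ≤ h ((x + y) / 2) ^ 2) :
    (∫⁻ x, ENNReal.ofReal (f x)) * (∫⁻ x, ENNReal.ofReal (g x)) ≤
      (∫⁻ x, ENNReal.ofReal (h x)) ^ 2 := by
  set F := sSup (range f) with hF
  set G := sSup (range g) with hG
  have fF : ∀ x, f x ≤ F := fun x => le_csSup fb ⟨x, rfl⟩
  have gG : ∀ x, g x ≤ G := fun x => le_csSup gb ⟨x, rfl⟩
  rcases ((f0 0).trans (fF 0)).eq_or_lt with hF0 | hF0
  · have : f = 0 := funext fun x => le_antisymm ((fF x).trans hF0.ge) (f0 x)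
    simp [this]
  rcases ((g0 0).trans (gG 0)).eq_or_lt with hG0 | hG0
  · have : g = 0 := funext fun x => le_antisymm ((gG x).trans hG0.ge) (g0 x)
    simp [this]
  -- Dividing `f`, `g`, `h` by `F`, `G`, `√(F G)` preserves the midpoint condition and brings both
  -- suprema to 1; AM-GM then turns the sum into a product.
  have hc : 0 < √(F * G) := Real.sqrt_pos.2 (mul_pos hF0 hG0)
  have key := lintegral_add_le_of_sup_eq_one (f := fun x => f x / F) (g := fun x => g x / G)
    (h := fun x => h x / √(F * G)) (hf.div_const _) (hg.div_const _) (hh.div_const _)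
    (fun x => div_nonneg (f0 x) hF0.le) (fun x => div_nonneg (g0 x) hG0.le)
    (fun x => div_nonneg (h0 x) hc.le) (fun x => (div_le_one hF0).2 (fF x))
    (fun x => (div_le_one hG0).2 (gG x)) ?_ ?_ ?_
  · have scale : ∀ (k : ℝ → ℝ) (c : ℝ), 0 < c → ∫⁻ x, ENNReal.ofReal (k x) =
        ENNReal.ofReal c * ∫⁻ x, ENNReal.ofReal (k x / c) := by
      intro k c hc
      rw [← lintegral_const_mul' _ _ (by simp)]
      refine lintegral_congr fun x => ?_
      rw [← ENNReal.ofReal_mul hc.le, mul_div_cancel₀ _ hc.ne']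
    rw [scale f F hF0, scale g G hG0, scale h _ hc, mul_mul_mul_comm, mul_pow,
      ← ENNReal.ofReal_mul hF0.le, ← ENNReal.ofReal_pow hc.le, Real.sq_sqrt (by positivity)]
    gcongr
    exact mul_le_sq_of_add_le_two_mul key
  · intro t ht
    obtain ⟨_, ⟨x, rfl⟩, hx⟩ := exists_lt_of_lt_csSup (range_nonempty f)
      (show t * F < sSup (range f) by rw [← hF]; nlinarith)
    exact ⟨x, (lt_div_iff₀ hF0).2 hx⟩
  · intro t ht
    obtain ⟨_, ⟨x, rfl⟩, hx⟩ := exists_lt_of_lt_csSup (range_nonempty g)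
      (show t * G < sSup (range g) by rw [← hG]; nlinarith)
    exact ⟨x, (lt_div_iff₀ hG0).2 hx⟩
  · intro x y
    rw [div_pow, Real.sq_sqrt (by positivity), div_mul_div_comm]
    gcongr
    exact hfgh x y

/-- A measure satisfies the (midpoint) Prékopa-Leindler inequality, for test functions bounded
by one. -/
def PrekopaLeindler {E : Type*} [AddCommGroup E] [Module ℝ E] [MeasurableSpace E]
    (μ : Measure E) : Prop :=
  ∀ f g h : E → ℝ≥0∞, Measurable f → Measurable g → Measurable h → (∀ x, f x ≤ 1) →
    (∀ x, g x ≤ 1) → (∀ x y, f x * g y ≤ h ((1 / 2 : ℝ) • (x + y)) ^ 2) →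
    (∫⁻ x, f x ∂μ) * (∫⁻ x, g x ∂μ) ≤ (∫⁻ x, h x ∂μ) ^ 2

lemma gaussianPDFReal_mul_le (x y : ℝ) : gaussianPDFReal 0 1 x * gaussianPDFReal 0 1 y ≤
    gaussianPDFReal 0 1 ((x + y) / 2) ^ 2 := by
  simp only [gaussianPDFReal, NNReal.coe_one, mul_one, sub_zero]
  rw [mul_pow, mul_mul_mul_comm, ← sq, ← Real.exp_add, ← Real.exp_nat_mul]
  gcongr
  push_cast
  nlinarith [sq_nonneg (x - y)]

/-- The Gaussian density is log-concave, so it can be absorbed into the three test functions and the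
Lebesgue inequality applied. -/
lemma prekopaLeindler_gaussianReal : PrekopaLeindler (gaussianReal 0 1) := by
  intro f g h hf hg hh f1 g1 hfgh
  have conv : ∀ k : ℝ → ℝ≥0∞, Measurable k → (∀ x, k x ≤ 1) → ∫⁻ x, k x ∂(gaussianReal 0 1) =
      ∫⁻ x, ENNReal.ofReal ((k x).toReal * gaussianPDFReal 0 1 x) := by
    intro k hk k1
    rw [gaussianReal_of_var_ne_zero _ one_ne_zero,
      lintegral_withDensity_eq_lintegral_mul _ (measurable_gaussianPDF 0 1) hk]
    refine lintegral_congr fun x => ?_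
    rw [ENNReal.ofReal_mul ENNReal.toReal_nonneg,
      ENNReal.ofReal_toReal (ne_top_of_le_ne_top ENNReal.one_ne_top (k1 x)), mul_comm]
    rfl
  have bdd : ∀ k : ℝ → ℝ≥0∞, (∀ x, k x ≤ 1) →
      BddAbove (range fun x => (k x).toReal * gaussianPDFReal 0 1 x) := by
    intro k k1
    refine ⟨gaussianPDFReal 0 1 0, ?_⟩
    rintro _ ⟨x, rfl⟩
    have h1 : (k x).toReal ≤ 1 := ENNReal.toReal_le_of_le_ofReal zero_le_one (by simpa using k1 x)
    have h2 : gaussianPDFReal 0 1 x ≤ gaussianPDFReal 0 1 0 := by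
      simp only [gaussianPDFReal, NNReal.coe_one, mul_one, sub_zero]
      refine mul_le_mul_of_nonneg_left (Real.exp_le_exp.2 ?_) (by positivity)
      have := sq_nonneg x
      linarith [show (0 : ℝ) ^ 2 = 0 by norm_num]
    nlinarith [gaussianPDFReal_nonneg 0 1 x, ENNReal.toReal_nonneg (a := k x)]
  -- `h` may be infinite; truncating it at 1 makes it real-valued and keeps the midpoint condition,
  -- since `f` and `g` are at most 1.
  have m1 : ∀ x, min (h x) 1 ≤ 1 := fun x => min_le_right _ _
  have mm : Measurable fun x => min (h x) 1 := hh.min measurable_const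
  have pdfm := measurable_gaussianPDFReal 0 1
  calc (∫⁻ x, f x ∂(gaussianReal 0 1)) * (∫⁻ x, g x ∂(gaussianReal 0 1))
      ≤ (∫⁻ x, min (h x) 1 ∂(gaussianReal 0 1)) ^ 2 := by
        rw [conv f hf f1, conv g hg g1, conv _ mm m1]
        refine lintegral_mul_lintegral_le_sq (hf.ennreal_toReal.mul pdfm)
          (hg.ennreal_toReal.mul pdfm) (mm.ennreal_toReal.mul pdfm)
          (fun x => mul_nonneg ENNReal.toReal_nonneg (gaussianPDFReal_nonneg _ _ _))
          (fun x => mul_nonneg ENNReal.toReal_nonneg (gaussianPDFReal_nonneg _ _ _))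
          (fun x => mul_nonneg ENNReal.toReal_nonneg (gaussianPDFReal_nonneg _ _ _))
          (bdd f f1) (bdd g g1) ?_
        intro x y
        rw [mul_mul_mul_comm, mul_pow]
        refine mul_le_mul ?_ (gaussianPDFReal_mul_le x y)
          (mul_nonneg (gaussianPDFReal_nonneg _ _ _) (gaussianPDFReal_nonneg _ _ _))
          (by positivity)
        rw [← ENNReal.toReal_mul, ← ENNReal.toReal_pow]
        refine ENNReal.toReal_mono (ENNReal.pow_ne_top
          (ne_top_of_le_ne_top ENNReal.one_ne_top (m1 _))) ?_
        have h1 := hfgh x y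
        rw [show (1 / 2 : ℝ) • (x + y) = (x + y) / 2 by simp; ring] at h1
        rcases le_total (h ((x + y) / 2)) 1 with hle | hle
        · rwa [min_eq_left hle]
        · rw [min_eq_right hle, one_pow]
          exact mul_le_one' (f1 x) (g1 y)
    _ ≤ _ := by
        gcongr
        exact min_le_left _ _

variable {E F : Type*} [AddCommGroup E] [Module ℝ E] [MeasurableSpace E]
  [AddCommGroup F] [Module ℝ F] [MeasurableSpace F]

/-- By Fubini: the inequality for `ν` on fibres is exactly the midpoint condition for the three
partial integrals, to which the inequality for `μ` applies. -/
lemma PrekopaLeindler.prod {μ : Measure E} {ν : Measure F} [SFinite μ] [IsProbabilityMeasure ν]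
    (hμ : PrekopaLeindler μ) (hν : PrekopaLeindler ν) : PrekopaLeindler (μ.prod ν) := by
  intro f g h hf hg hh f1 g1 hfgh
  rw [lintegral_prod _ hf.aemeasurable, lintegral_prod _ hg.aemeasurable,
    lintegral_prod _ hh.aemeasurable]
  have le1 : ∀ k : E × F → ℝ≥0∞, (∀ p, k p ≤ 1) → ∀ x, ∫⁻ y, k (x, y) ∂ν ≤ 1 := fun k k1 x =>
    (lintegral_mono fun y => k1 (x, y)).trans (by simp)
  refine hμ _ _ _ hf.lintegral_prod_right' hg.lintegral_prod_right' hh.lintegral_prod_right'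
    (le1 f f1) (le1 g g1) fun x x' => ?_
  exact hν _ _ _ (hf.comp measurable_prodMk_left) (hg.comp measurable_prodMk_left)
    (hh.comp measurable_prodMk_left) (fun y => f1 _) (fun y => g1 _) fun y y' => hfgh (x, y) (x', y')

lemma PrekopaLeindler.map {μ : Measure E} (hμ : PrekopaLeindler μ) (L : E →ₗ[ℝ] F)
    (hL : Measurable L) : PrekopaLeindler (μ.map L) := by
  intro f g h hf hg hh f1 g1 hfgh
  rw [lintegral_map hf hL, lintegral_map hg hL, lintegral_map hh hL]
  refine hμ _ _ _ (hf.comp hL) (hg.comp hL) (hh.comp hL) (fun x => f1 _) (fun x => g1 _) ?_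
  intro x y
  have := hfgh (L x) (L y)
  simpa using this

lemma prekopaLeindler_dirac [MeasurableSingletonClass E] : PrekopaLeindler (Measure.dirac (0 : E)) := by
  intro f g h hf hg hh f1 g1 hfgh
  simpa using hfgh 0 0

lemma prekopaLeindler_pi_gaussianReal (n : ℕ) :
    PrekopaLeindler (Measure.pi fun _ : Fin n => gaussianReal 0 1) := by
  induction n with
  | zero =>
    rw [Measure.pi_of_empty _ 0]
    exact prekopaLeindler_dirac
  | succ n ih =>
    have h := (measurePreserving_piFinSuccAbove (fun _ : Fin (n + 1) => gaussianReal 0 1) 0).symm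
    rw [← h.map_eq]
    exact (prekopaLeindler_gaussianReal.prod ih).map
      { toFun := (MeasurableEquiv.piFinSuccAbove (fun _ : Fin (n + 1) => ℝ) 0).symm
        map_add' := fun x y => by
          ext i; refine Fin.cases ?_ (fun j => ?_) i <;> simp [MeasurableEquiv.piFinSuccAbove]
        map_smul' := fun c x => by
          ext i; refine Fin.cases ?_ (fun j => ?_) i <;> simp [MeasurableEquiv.piFinSuccAbove] }
      h.measurable

lemma prekopaLeindler_stdGaussian {V : Type*} [NormedAddCommGroup V] [InnerProductSpace ℝ V]
    [FiniteDimensional ℝ V] [MeasurableSpace V] [BorelSpace V] :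
    PrekopaLeindler (stdGaussian V) := by
  refine (prekopaLeindler_pi_gaussianReal _).map
    { toFun := fun x => ∑ i, x i • stdOrthonormalBasis ℝ V i
      map_add' := fun x y => by simp [add_smul, Finset.sum_add_distrib]
      map_smul' := fun c x => by simp [Finset.smul_sum, mul_smul] } ?_
  change Measurable fun x : Fin (Module.finrank ℝ V) → ℝ => ∑ i, x i • stdOrthonormalBasis ℝ V i
  fun_prop

/-- The measure is a linear image of the standard Gaussian, so no density is needed and singular
covariances are covered. -/
lemma prekopaLeindler_multivariateGaussian {ι : Type*} [Fintype ι] [DecidableEq ι]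
    (S : Matrix ι ι ℝ) : PrekopaLeindler (multivariateGaussian 0 S) := by
  unfold multivariateGaussian
  simp only [zero_add]
  exact prekopaLeindler_stdGaussian.map
    (Matrix.toEuclideanCLM (𝕜 := ℝ) (CFC.sqrt S) :
      EuclideanSpace ℝ ι →L[ℝ] EuclideanSpace ℝ ι).toLinearMap (by
      exact ContinuousLinearMap.measurable _)

/-- Anderson's inequality: translating a symmetric convex set decreases its measure. -/
lemma PrekopaLeindler.measure_add_mem_le [MeasurableAdd E] [MeasurableNeg E] {μ : Measure E}
    (hμ : PrekopaLeindler μ)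
    (hneg : μ.map (fun x => -x) = μ) {C : Set E} (hC : MeasurableSet C) (hconv : Convex ℝ C)
    (hsymm : ∀ x ∈ C, -x ∈ C) (w : E) : μ {x | x + w ∈ C} ≤ μ C := by
  have hm : ∀ v : E, MeasurableSet {x | x + v ∈ C} := fun v => hC.preimage (measurable_add_const v)
  have heq : μ {x | x + -w ∈ C} = μ {x | x + w ∈ C} := by
    conv_rhs => rw [← hneg, Measure.map_apply measurable_neg (hm w)]
    congr 1
    ext x
    simp only [mem_ofPred_eq, preimage_ofPred_eq]
    constructor
    · intro h; simpa [add_comm] using hsymm _ h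
    · intro h; simpa [add_comm] using hsymm _ h
  -- If `x + w` and `y - w` lie in `C`, so does their midpoint `(x + y) / 2`. The two translates
  -- have equal mass by symmetry (`heq`), so the inequality compares squares.
  have key := hμ ({x | x + w ∈ C}.indicator 1) ({x | x + -w ∈ C}.indicator 1) (C.indicator 1)
    (measurable_one.indicator (hm _)) (measurable_one.indicator (hm _))
    (measurable_one.indicator hC) (fun x => indicator_le_self' (by simp) x)
    (fun x => indicator_le_self' (by simp) x) ?_
  · rw [lintegral_indicator_one (hm _), lintegral_indicator_one (hm _),
      lintegral_indicator_one hC, heq, ← sq] at key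
    exact (ENNReal.pow_le_pow_left_iff two_ne_zero).1 key
  · intro x y
    by_cases hx : x + w ∈ C
    · by_cases hy : y + -w ∈ C
      · have : (1 / 2 : ℝ) • (x + y) ∈ C := by
          have := hconv hx hy (a := 1 / 2) (b := 1 / 2) (by norm_num) (by norm_num) (by norm_num)
          convert this using 1
          module
        rw [indicator_of_mem this]
        simp [hx, hy]
      · simp [hy]
    · simp [hx]

/-- Anderson's inequality averaged over a random translation with law `ν`. -/
lemma PrekopaLeindler.conv_le [MeasurableAdd₂ E] [MeasurableNeg E] {μ ν : Measure E}
    [SFinite μ] [IsProbabilityMeasure ν]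
    (hμ : PrekopaLeindler μ) (hneg : μ.map (fun x => -x) = μ) {C : Set E} (hC : MeasurableSet C)
    (hconv : Convex ℝ C) (hsymm : ∀ x ∈ C, -x ∈ C) : (ν ∗ μ) C ≤ μ C := by
  rw [Measure.conv, Measure.map_apply (by fun_prop) hC,
    Measure.prod_apply (hC.preimage (by fun_prop))]
  calc _ ≤ ∫⁻ _ : E, μ C ∂ν := by
        refine lintegral_mono fun w => ?_
        simpa [preimage_ofPred_eq, preimage, add_comm] using
          hμ.measure_add_mem_le hneg hC hconv hsymm w
    _ = μ C := by simp

end PrekopaLeindler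

/-! ### Wiener integrals: linearity, isometry and characteristic function -/

section WienerIntegral

variable {Ω : Type*} [MeasurableSpace Ω]

lemma integral_sq_eq_eLpNorm_sq {α : Type*} [MeasurableSpace α] {μ : Measure α} {f : α → ℝ}
    (hf : MemLp f 2 μ) : ∫ x, f x ^ 2 ∂μ = (eLpNorm f 2 μ).toReal ^ 2 := by
  rw [hf.eLpNorm_eq_integral_rpow_norm two_ne_zero (by simp)]
  have h0 : 0 ≤ ∫ x, ‖f x‖ ^ (2 : ℝ≥0∞).toReal ∂μ := integral_nonneg fun x => by positivity
  rw [ENNReal.toReal_ofReal (by positivity), ← Real.rpow_natCast, ← Real.rpow_mul h0]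
  simp

lemma eLpNorm_two_congr {α β : Type*} [MeasurableSpace α] [MeasurableSpace β] {μ : Measure α}
    {ν : Measure β} {f : α → ℝ} {g : β → ℝ} (hf : MemLp f 2 μ) (hg : MemLp g 2 ν)
    (h : ∫ x, f x ^ 2 ∂μ = ∫ x, g x ^ 2 ∂ν) : eLpNorm f 2 μ = eLpNorm g 2 ν := by
  rw [integral_sq_eq_eLpNorm_sq hf, integral_sq_eq_eLpNorm_sq hg] at h
  have := (pow_left_inj₀ ENNReal.toReal_nonneg ENNReal.toReal_nonneg two_ne_zero).1 h
  exact (ENNReal.toReal_eq_toReal_iff' hf.eLpNorm_ne_top hg.eLpNorm_ne_top).1 this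

lemma tendsto_toReal_eLpNorm_two {α : Type*} [MeasurableSpace α] {μ : Measure α} {f : α → ℝ}
    {u : ℕ → α → ℝ} (hf : MemLp f 2 μ) (hu : ∀ k, MemLp (u k) 2 μ)
    (h : Tendsto (fun k => eLpNorm (fun x => f x - u k x) 2 μ) atTop (𝓝 0)) :
    Tendsto (fun k => (eLpNorm (u k) 2 μ).toReal) atTop (𝓝 (eLpNorm f 2 μ).toReal) := by
  have h' : Tendsto (fun k => (eLpNorm (fun x => f x - u k x) 2 μ).toReal) atTop (𝓝 0) := by
    exact (ENNReal.tendsto_toReal ENNReal.zero_ne_top).comp h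
  rw [tendsto_iff_dist_tendsto_zero]
  refine squeeze_zero (fun _ => dist_nonneg) (fun k => ?_) h'
  have e1 : (eLpNorm (u k) 2 μ).toReal = ‖(hu k).toLp‖ := (Lp.norm_toLp _ _).symm
  have e2 : (eLpNorm f 2 μ).toReal = ‖hf.toLp‖ := (Lp.norm_toLp _ _).symm
  have e3 : (eLpNorm (fun x => f x - u k x) 2 μ).toReal = ‖hf.toLp - (hu k).toLp‖ := by
    rw [← MemLp.toLp_sub, Lp.norm_toLp]
    rfl
  rw [e1, e2, e3, norm_sub_rev, dist_eq_norm]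
  exact abs_norm_sub_norm_le _ _

lemma StepFun.memLp_eval (φ : StepFun) : MemLp φ.eval 2 volume := by
  unfold StepFun.eval
  exact memLp_finsetSum _ fun i _ => memLp_indicator_const 2 measurableSet_Ioc _ (Or.inr (by simp))

lemma IsWienerProcess.memLp {W : ℝ → Ω → ℝ} {P : Measure Ω} (hW : IsWienerProcess W P) (t : ℝ) :
    MemLp (W t) 2 P := (hW.gaussian.hasGaussianLaw_eval t).memLp_two

lemma StepFun.memLp_integral (φ : StepFun) {W : ℝ → Ω → ℝ} {P : Measure Ω}
    (hW : IsWienerProcess W P) : MemLp (φ.integral W) 2 P := by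
  unfold StepFun.integral
  exact memLp_finsetSum _ fun i _ => ((hW.memLp _).sub (hW.memLp _)).const_mul _

/-- Puts the length of the overlap in the form in which the Wiener covariance gives the covariance
of two increments. -/
lemma volume_real_Ioc_inter_Ioc {l r l' r' : ℝ} (h : l ≤ r) (h' : l' ≤ r') :
    volume.real (Ioc l r ∩ Ioc l' r') = (|r - l'| + |l - r'| - |r - r'| - |l - l'|) / 2 := by
  rw [Ioc_inter_Ioc, Real.volume_real_Ioc]
  simp only [max_def, min_def, abs_eq_max_neg]
  split_ifs <;> linarith

lemma IsWienerProcess.integral_increment_mul {W : ℝ → Ω → ℝ} {P : Measure Ω}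
    (hW : IsWienerProcess W P) (l r l' r' : ℝ) :
    ∫ ω, (W r ω - W l ω) * (W r' ω - W l' ω) ∂P =
      (|r - l'| + |l - r'| - |r - r'| - |l - l'|) / 2 := by
  have hi : ∀ s t, Integrable (fun ω => W s ω * W t ω) P := fun s t =>
    (hW.memLp s).integrable_mul (hW.memLp t)
  have : ∀ ω, (W r ω - W l ω) * (W r' ω - W l' ω) =
      (W r ω * W r' ω - W r ω * W l' ω) - (W l ω * W r' ω - W l ω * W l' ω) := fun ω => by ring
  simp_rw [this]
  rw [integral_sub (f := fun ω => W r ω * W r' ω - W r ω * W l' ω)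
    (g := fun ω => W l ω * W r' ω - W l ω * W l' ω)
    ((hi _ _).sub (hi _ _)) ((hi _ _).sub (hi _ _)), integral_sub (hi _ _) (hi _ _),
    integral_sub (hi _ _) (hi _ _)]
  simp_rw [hW.cov_eq]
  ring

lemma StepFun.integral_sq (φ : StepFun) {W : ℝ → Ω → ℝ} {P : Measure Ω}
    (hW : IsWienerProcess W P) : ∫ ω, φ.integral W ω ^ 2 ∂P = ∫ s, φ.eval s ^ 2 := by
  have hinc : ∀ i, MemLp (fun ω => W (φ.r i) ω - W (φ.l i) ω) 2 P := fun i =>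
    (hW.memLp _).sub (hW.memLp _)
  have hind : ∀ i j, Integrable (fun s => (Ioc (φ.l i) (φ.r i) ∩ Ioc (φ.l j) (φ.r j)).indicator
      (fun _ => φ.c i * φ.c j) s) := fun i j =>
    (integrable_indicator_iff (measurableSet_Ioc.inter measurableSet_Ioc)).2 <|
      integrableOn_const ((measure_mono inter_subset_left).trans_lt (by simp)).ne
  have e1 : ∀ ω, φ.integral W ω ^ 2 = ∑ i, ∑ j, φ.c i * φ.c j *
      ((W (φ.r i) ω - W (φ.l i) ω) * (W (φ.r j) ω - W (φ.l j) ω)) := by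
    intro ω
    rw [StepFun.integral, sq, Finset.sum_mul_sum]
    exact Finset.sum_congr rfl fun i _ => Finset.sum_congr rfl fun j _ => by ring
  have e2 : ∀ s, φ.eval s ^ 2 = ∑ i, ∑ j, (Ioc (φ.l i) (φ.r i) ∩ Ioc (φ.l j) (φ.r j)).indicator
      (fun _ => φ.c i * φ.c j) s := by
    intro s
    rw [StepFun.eval, sq, Finset.sum_mul_sum]
    exact Finset.sum_congr rfl fun i _ => Finset.sum_congr rfl fun j _ => by
      rw [inter_indicator_mul]
  simp_rw [e1, e2]
  have hmul : ∀ i j, Integrable (fun ω => φ.c i * φ.c j *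
      ((W (φ.r i) ω - W (φ.l i) ω) * (W (φ.r j) ω - W (φ.l j) ω))) P := fun i j =>
    ((hinc i).integrable_mul (hinc j)).const_mul _
  rw [integral_finsetSum _ fun i _ => integrable_finsetSum _ fun j _ => hmul i j,
    integral_finsetSum _ fun i _ => integrable_finsetSum _ fun j _ => hind i j]
  refine Finset.sum_congr rfl fun i _ => ?_
  rw [integral_finsetSum _ fun j _ => hmul i j, integral_finsetSum _ fun j _ => hind i j]
  refine Finset.sum_congr rfl fun j _ => ?_
  rw [integral_const_mul, hW.integral_increment_mul,
    integral_indicator_const _ (measurableSet_Ioc.inter measurableSet_Ioc),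
    volume_real_Ioc_inter_Ioc (φ.le i) (φ.le j), smul_eq_mul]
  ring

lemma StepFun.hasGaussianLaw_integral (φ : StepFun) {W : ℝ → Ω → ℝ} {P : Measure Ω}
    (hW : IsWienerProcess W P) : HasGaussianLaw (φ.integral W) P := by
  -- The integral is a linear combination of the values of `W` at right ends (weights `c`) and left
  -- ends (weights `-c`), indexed by a disjoint sum.
  have h := ((hW.gaussian.comp_right (Sum.elim φ.r φ.l)).smul
    (Sum.elim φ.c fun i => -φ.c i)).hasGaussianLaw_fun_sum (I := Finset.univ)
  have e : φ.integral W = fun ω => ∑ i, Sum.elim φ.c (fun i => -φ.c i) i •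
      (W ∘ Sum.elim φ.r φ.l) i ω := by
    ext ω
    simp [StepFun.integral, mul_sub, Finset.sum_sub_distrib, ← sub_eq_add_neg]
  rw [e]
  exact h

lemma StepFun.integral_integral_eq_zero (φ : StepFun) {W : ℝ → Ω → ℝ} {P : Measure Ω}
    (hW : IsWienerProcess W P) : ∫ ω, φ.integral W ω ∂P = 0 := by
  have hi : ∀ t, Integrable (W t) P := fun t => (hW.gaussian.hasGaussianLaw_eval t).integrable
  unfold StepFun.integral
  rw [integral_finsetSum (f := fun i ω => φ.c i * (W (φ.r i) ω - W (φ.l i) ω)) _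
    fun i _ => ((hi _).sub (hi _)).const_mul _]
  refine Finset.sum_eq_zero fun i _ => ?_
  rw [integral_const_mul, integral_sub (hi _) (hi _), hW.mean_zero, hW.mean_zero]
  simp

lemma HasGaussianLaw.integral_cexp {P : Measure Ω} {J : Ω → ℝ} (hJ : HasGaussianLaw J P)
    (h0 : ∫ ω, J ω ∂P = 0) :
    ∫ ω, Complex.exp (J ω * Complex.I) ∂P = Complex.exp (-((∫ ω, J ω ^ 2 ∂P : ℝ) : ℂ) / 2) := by
  have := hJ.isProbabilityMeasure
  have h := congrArg (fun μ => charFun μ 1) hJ.map_eq_gaussianReal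
  simp only [charFun_gaussianReal] at h
  rw [charFun_apply_real, integral_map hJ.aemeasurable (by fun_prop)] at h
  have hv : Var[J; P] = ∫ ω, J ω ^ 2 ∂P := by
    rw [variance_of_integral_eq_zero hJ.aemeasurable h0]
  rw [hv, h0] at h
  rw [Real.coe_toNNReal _ (integral_nonneg fun ω => sq_nonneg _)] at h
  simp only [Complex.ofReal_one, one_mul] at h
  rw [h]
  congr 1
  simp
  ring

/-- `x ↦ exp(i x)` is 1-Lipschitz and, on a probability space, the `L₁` norm is at most the `L₂`
norm. -/
lemma tendsto_integral_cexp {P : Measure Ω} [IsProbabilityMeasure P] {J : Ω → ℝ} {u : ℕ → Ω → ℝ}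
    (hJ : MemLp J 2 P) (hu : ∀ k, MemLp (u k) 2 P)
    (h : Tendsto (fun k => eLpNorm (fun ω => J ω - u k ω) 2 P) atTop (𝓝 0)) :
    Tendsto (fun k => ∫ ω, Complex.exp (u k ω * Complex.I) ∂P) atTop
      (𝓝 (∫ ω, Complex.exp (J ω * Complex.I) ∂P)) := by
  have int : ∀ {v : Ω → ℝ}, MemLp v 2 P → Integrable (fun ω => Complex.exp (v ω * Complex.I)) P := by
    intro v hv
    refine Integrable.of_bound (C := 1) ?_ (ae_of_all _ fun ω => by simp)
    exact (Complex.continuous_exp.comp (by fun_prop : Continuous fun x : ℝ =>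
      (x : ℂ) * Complex.I)).comp_aestronglyMeasurable hv.1
  rw [tendsto_iff_edist_tendsto_0]
  refine tendsto_of_tendsto_of_tendsto_of_le_of_le tendsto_const_nhds h (fun _ => zero_le) fun k => ?_
  simp only
  rw [edist_comm, edist_eq_enorm_sub, ← integral_sub (int hJ) (int (hu k))]
  calc _ ≤ ∫⁻ ω, ‖Complex.exp (J ω * Complex.I) - Complex.exp (u k ω * Complex.I)‖ₑ ∂P :=
        enorm_integral_le_lintegral_enorm _
    _ ≤ ∫⁻ ω, ‖J ω - u k ω‖ₑ ∂P := by
        refine lintegral_mono fun ω => ?_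
        have : Complex.exp (J ω * Complex.I) - Complex.exp (u k ω * Complex.I) =
            Complex.exp (u k ω * Complex.I) *
              (Complex.exp (Complex.I * ((J ω - u k ω : ℝ) : ℂ)) - 1) := by
          rw [mul_sub, ← Complex.exp_add]
          push_cast
          ring_nf
        rw [this, enorm_mul, ← ofReal_norm (Complex.exp (u k ω * Complex.I)),
          Complex.norm_exp_ofReal_mul_I, ENNReal.ofReal_one, one_mul]
        exact Real.enorm_exp_I_mul_ofReal_sub_one_le
    _ = eLpNorm (fun ω => J ω - u k ω) 1 P := eLpNorm_one_eq_lintegral_enorm.symm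
    _ ≤ _ := eLpNorm_le_eLpNorm_of_exponent_le (by norm_num) (hJ.sub (hu k)).1

variable {W : ℝ → Ω → ℝ} {P : Measure Ω} {f g : ℝ → ℝ} {J K : Ω → ℝ}

lemma IsWienerIntegral.eLpNorm_eq (hW : IsWienerProcess W P) (h : IsWienerIntegral W P f J) :
    (eLpNorm J 2 P).toReal = (eLpNorm f 2 volume).toReal := by
  obtain ⟨hf, hJ, φ, h1, h2⟩ := h
  have t1 := tendsto_toReal_eLpNorm_two hf (fun k => (φ k).memLp_eval) h1
  have t2 := tendsto_toReal_eLpNorm_two hJ (fun k => (φ k).memLp_integral hW) h2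
  refine tendsto_nhds_unique t2 (t1.congr fun k => ?_)
  rw [eLpNorm_two_congr ((φ k).memLp_eval) ((φ k).memLp_integral hW) ((φ k).integral_sq hW).symm]

/-- The Itô isometry for Wiener integrals. -/
lemma IsWienerIntegral.integral_sq (hW : IsWienerProcess W P) (h : IsWienerIntegral W P f J) :
    ∫ ω, J ω ^ 2 ∂P = ∫ s, f s ^ 2 := by
  rw [integral_sq_eq_eLpNorm_sq h.2.1, integral_sq_eq_eLpNorm_sq h.1, h.eLpNorm_eq hW]

/-- The characteristic function of a Wiener integral, at `1`. -/
lemma IsWienerIntegral.integral_cexp [IsProbabilityMeasure P] (hW : IsWienerProcess W P)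
    (h : IsWienerIntegral W P f J) :
    ∫ ω, Complex.exp (J ω * Complex.I) ∂P = Complex.exp (-((∫ s, f s ^ 2 : ℝ) : ℂ) / 2) := by
  obtain ⟨hf, hJ, φ, h1, h2⟩ := h
  have t1 := tendsto_toReal_eLpNorm_two hf (fun k => (φ k).memLp_eval) h1
  have t2 := tendsto_integral_cexp hJ (fun k => (φ k).memLp_integral hW) h2
  refine tendsto_nhds_unique t2 ?_
  have e : ∀ k, ∫ ω, Complex.exp ((φ k).integral W ω * Complex.I) ∂P =
      Complex.exp (-((((eLpNorm (φ k).eval 2 volume).toReal ^ 2 : ℝ)) : ℂ) / 2) := by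
    intro k
    rw [HasGaussianLaw.integral_cexp ((φ k).hasGaussianLaw_integral hW)
      ((φ k).integral_integral_eq_zero hW), (φ k).integral_sq hW,
      integral_sq_eq_eLpNorm_sq (φ k).memLp_eval]
  simp_rw [e, integral_sq_eq_eLpNorm_sq hf]
  exact (Complex.continuous_exp.tendsto _).comp
    ((((Complex.continuous_ofReal.tendsto _).comp (t1.pow 2)).neg).div_const 2)

/-- The sum of two step functions. -/
def StepFun.add (φ ψ : StepFun) : StepFun where
  n := φ.n + ψ.n
  c := Fin.append φ.c ψ.c
  l := Fin.append φ.l ψ.l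
  r := Fin.append φ.r ψ.r
  le i := by refine Fin.addCases (fun i => ?_) (fun i => ?_) i <;> simp [φ.le, ψ.le]

lemma StepFun.eval_add (φ ψ : StepFun) (s : ℝ) : (φ.add ψ).eval s = φ.eval s + ψ.eval s := by
  simp only [StepFun.eval]
  refine (Fin.sum_univ_add (a := φ.n) (b := ψ.n) _).trans ?_
  simp [StepFun.add]

lemma StepFun.integral_add {Ω : Type*} (φ ψ : StepFun) (W : ℝ → Ω → ℝ) (ω : Ω) :
    (φ.add ψ).integral W ω = φ.integral W ω + ψ.integral W ω := by
  simp only [StepFun.integral]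
  refine (Fin.sum_univ_add (a := φ.n) (b := ψ.n) _).trans ?_
  simp [StepFun.add]

/-- A scalar multiple of a step function. -/
def StepFun.smul (a : ℝ) (φ : StepFun) : StepFun where
  n := φ.n
  c i := a * φ.c i
  l := φ.l
  r := φ.r
  le := φ.le

lemma StepFun.eval_smul (a : ℝ) (φ : StepFun) (s : ℝ) : (φ.smul a).eval s = a * φ.eval s := by
  simp only [StepFun.eval, StepFun.smul, Finset.mul_sum]
  exact Finset.sum_congr rfl fun i _ => indicator_const_mul _ _ _ _

lemma StepFun.integral_smul {Ω : Type*} (a : ℝ) (φ : StepFun) (W : ℝ → Ω → ℝ) (ω : Ω) :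
    (φ.smul a).integral W ω = a * φ.integral W ω := by
  simp only [StepFun.integral, StepFun.smul, Finset.mul_sum, mul_assoc]
  rfl

lemma isWienerIntegral_zero : IsWienerIntegral W P (fun _ => 0) (fun _ => 0) := by
  refine ⟨MemLp.zero, MemLp.zero, fun _ => ⟨0, 0, 0, 0, fun _ => le_rfl⟩, ?_, ?_⟩ <;>
  simp [StepFun.eval, StepFun.integral]

lemma IsWienerIntegral.add (hW : IsWienerProcess W P) (hf : IsWienerIntegral W P f J)
    (hg : IsWienerIntegral W P g K) :
    IsWienerIntegral W P (fun s => f s + g s) (fun ω => J ω + K ω) := by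
  obtain ⟨hf1, hf2, φ, hf3, hf4⟩ := hf
  obtain ⟨hg1, hg2, ψ, hg3, hg4⟩ := hg
  refine ⟨hf1.add hg1, hf2.add hg2, fun k => (φ k).add (ψ k), ?_, ?_⟩
  · refine tendsto_of_tendsto_of_tendsto_of_le_of_le tendsto_const_nhds
      (by simpa using hf3.add hg3) (fun _ => zero_le) fun k => ?_
    refine le_trans (le_of_eq ?_) (eLpNorm_add_le (hf1.sub (φ k).memLp_eval).1
      (hg1.sub (ψ k).memLp_eval).1 (by norm_num))
    congr 1
    ext s
    simp only [StepFun.eval_add, Pi.add_apply]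
    ring
  · refine tendsto_of_tendsto_of_tendsto_of_le_of_le tendsto_const_nhds
      (by simpa using hf4.add hg4) (fun _ => zero_le) fun k => ?_
    refine le_trans (le_of_eq ?_) (eLpNorm_add_le (hf2.sub ((φ k).memLp_integral hW)).1
      (hg2.sub ((ψ k).memLp_integral hW)).1 (by norm_num))
    congr 1
    ext s
    simp only [StepFun.integral_add, Pi.add_apply]
    ring

lemma IsWienerIntegral.const_mul (a : ℝ) (hf : IsWienerIntegral W P f J) :
    IsWienerIntegral W P (fun s => a * f s) (fun ω => a * J ω) := by
  obtain ⟨hf1, hf2, φ, hf3, hf4⟩ := hf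
  refine ⟨hf1.const_mul a, hf2.const_mul a, fun k => (φ k).smul a, ?_, ?_⟩
  · have := ENNReal.Tendsto.const_mul (a := ‖a‖ₑ) hf3 (Or.inr enorm_ne_top)
    rw [mul_zero] at this
    refine this.congr fun k => ?_
    rw [← eLpNorm_const_smul]
    congr 1
    ext s
    simp [StepFun.eval_smul, mul_sub]
  · have := ENNReal.Tendsto.const_mul (a := ‖a‖ₑ) hf4 (Or.inr enorm_ne_top)
    rw [mul_zero] at this
    refine this.congr fun k => ?_
    rw [← eLpNorm_const_smul]
    congr 1
    ext s
    simp [StepFun.integral_smul, mul_sub]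

/-- Reduces the joint law of several Wiener integrals to the characteristic function of a single
one. -/
lemma IsWienerIntegral.sum (hW : IsWienerProcess W P) {ι : Type*} (I : Finset ι) {F : ι → ℝ → ℝ}
    {Y : ι → Ω → ℝ} (h : ∀ i, IsWienerIntegral W P (F i) (Y i)) (c : ι → ℝ) :
    IsWienerIntegral W P (fun s => ∑ i ∈ I, c i * F i s) (fun ω => ∑ i ∈ I, c i * Y i ω) := by
  classical
  induction I using Finset.induction_on with
  | empty => simpa using isWienerIntegral_zero
  | insert i I hi ih =>
    simp only [Finset.sum_insert hi]
    exact ((h i).const_mul (c i)).add hW ih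

end WienerIntegral

/-! ### The limiting covariance in the time domain -/

section Plancherel

/-- The isometry `f ↦ conj (f (t - ·))` of `L₂(ℝ)`. -/
def reflectConj (t : ℝ) (f : Lp ℂ 2 (volume : Measure ℝ)) : Lp ℂ 2 (volume : Measure ℝ) :=
  Lp.compMeasurePreserving (fun u => t - u) (volume.measurePreserving_sub_left t)
    ((Complex.conjCLE : ℂ →L[ℝ] ℂ).compLp f)

lemma coeFn_reflectConj (t : ℝ) (f : Lp ℂ 2 (volume : Measure ℝ)) :
    reflectConj t f =ᵐ[volume] fun u => conj (f (t - u)) := by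
  have h := (volume.measurePreserving_sub_left t).quasiMeasurePreserving.ae_eq_comp
    ((Complex.conjCLE : ℂ →L[ℝ] ℂ).coeFn_compLp f)
  exact (Lp.coeFn_compMeasurePreserving _ _).trans h

lemma continuous_reflectConj (t : ℝ) : Continuous (reflectConj t) :=
  (Lp.isometry_compMeasurePreserving _).continuous.comp
    ((Complex.conjCLE : ℂ →L[ℝ] ℂ).compLpL 2 volume).continuous

/-- The character `v ↦ exp (-2πi t v)` in `L∞(ℝ)`. -/
def modulation (t : ℝ) : Lp ℂ ∞ (volume : Measure ℝ) :=
  (memLp_top_of_bound (f := fun v : ℝ => Complex.exp (((-(2 * Real.pi * t * v) : ℝ) : ℂ) * Complex.I))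
    (Continuous.aestronglyMeasurable (by fun_prop)) 1
    (ae_of_all _ fun v => (Complex.norm_exp_ofReal_mul_I _).le)).toLp

/-- The reflection of a Schwartz function, conjugated. -/
def schwartzReflectConj (t : ℝ) (g : SchwartzMap ℝ ℂ) : SchwartzMap ℝ ℂ :=
  SchwartzMap.compCLMOfAntilipschitz ℝ (K := 1) (g := fun u : ℝ => t - u)
    (by fun_prop) (AntilipschitzWith.of_le_mul_dist fun x y => by
      rw [NNReal.coe_one, one_mul, dist_sub_left])
    (SchwartzMap.postcompCLM (Complex.conjCLE : ℂ →L[ℝ] ℂ) g)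

lemma schwartzReflectConj_apply (t : ℝ) (g : SchwartzMap ℝ ℂ) (u : ℝ) :
    schwartzReflectConj t g u = conj (g (t - u)) := rfl

lemma reflectConj_toLp (t : ℝ) (g : SchwartzMap ℝ ℂ) :
    reflectConj t (g.toLp 2) = (schwartzReflectConj t g).toLp 2 := by
  refine Lp.ext ((coeFn_reflectConj _ _).trans ?_)
  have h := (volume.measurePreserving_sub_left t).quasiMeasurePreserving.ae_eq_comp
    (g.coeFn_toLp 2 volume)
  filter_upwards [h, (schwartzReflectConj t g).coeFn_toLp 2 volume] with u h1 h2
  rw [h2, schwartzReflectConj_apply]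
  simp only [Function.comp_apply] at h1
  rw [h1]

lemma fourier_schwartzReflectConj (t : ℝ) (g : SchwartzMap ℝ ℂ) (v : ℝ) :
    𝓕 (schwartzReflectConj t g) v =
      Complex.exp (((-(2 * Real.pi * t * v) : ℝ) : ℂ) * Complex.I) * conj (𝓕 g v) := by
  rw [SchwartzMap.fourier_coe, SchwartzMap.fourier_coe, Real.fourier_real_eq_integral_exp_smul,
    Real.fourier_real_eq_integral_exp_smul, ← integral_conj, ← integral_const_mul,
    ← integral_sub_left_eq_self _ _ t]
  refine integral_congr_ae (ae_of_all _ fun u => ?_)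
  simp only [schwartzReflectConj_apply, sub_sub_cancel, smul_eq_mul, map_mul, ← Complex.exp_conj,
    Complex.conj_ofReal, Complex.conj_I]
  rw [← mul_assoc, ← Complex.exp_add]
  congr 2
  push_cast
  ring

/-- On Schwartz functions this is a change of variable in the Fourier integral. Both sides are
continuous on `L₂`, where Schwartz functions are dense. -/
lemma fourier_reflectConj (t : ℝ) (f : Lp ℂ 2 (volume : Measure ℝ)) :
    (𝓕 (reflectConj t f) : Lp ℂ 2 (volume : Measure ℝ)) =ᵐ[volume] fun v =>
      Complex.exp (((-(2 * Real.pi * t * v) : ℝ) : ℂ) * Complex.I) *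
        conj ((𝓕 f : Lp ℂ 2 (volume : Measure ℝ)) v) := by
  set B : Lp ℂ 2 (volume : Measure ℝ) → Lp ℂ 2 (volume : Measure ℝ) := fun h =>
    (ContinuousLinearMap.mul ℂ ℂ).holderL volume ∞ 2 2 (modulation t)
      ((Complex.conjCLE : ℂ →L[ℝ] ℂ).compLp h) with hB
  have hBae : ∀ h, B h =ᵐ[volume] fun v =>
      Complex.exp (((-(2 * Real.pi * t * v) : ℝ) : ℂ) * Complex.I) * conj (h v) := by
    intro h
    refine ((ContinuousLinearMap.mul ℂ ℂ).coeFn_holder _ _).trans ?_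
    filter_upwards [MemLp.coeFn_toLp (memLp_top_of_bound
      (f := fun v : ℝ => Complex.exp (((-(2 * Real.pi * t * v) : ℝ) : ℂ) * Complex.I))
      (μ := volume) (Continuous.aestronglyMeasurable (by fun_prop)) 1
      (ae_of_all _ fun v => (Complex.norm_exp_ofReal_mul_I _).le)),
      (Complex.conjCLE : ℂ →L[ℝ] ℂ).coeFn_compLp h] with v h1 h2
    rw [modulation, h1, h2]
    rfl
  have hBc : Continuous B := (ContinuousLinearMap.continuous _).comp
    ((Complex.conjCLE : ℂ →L[ℝ] ℂ).compLpL 2 volume).continuous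
  have key : 𝓕 (reflectConj t f) = B (𝓕 f) := by
    refine DenseRange.induction_on
      (p := fun f : Lp ℂ 2 (volume : Measure ℝ) => 𝓕 (reflectConj t f) = B (𝓕 f))
      (SchwartzMap.denseRange_toLpCLM (F := ℂ) (μ := (volume : Measure ℝ)) (p := 2)
        ENNReal.ofNat_ne_top) f
      (isClosed_eq ?_ ?_) fun g => ?_
    · exact (Lp.fourierTransformₗᵢ ℝ ℂ).continuous.comp (continuous_reflectConj t)
    · exact hBc.comp (Lp.fourierTransformₗᵢ ℝ ℂ).continuous
    · rw [SchwartzMap.toLpCLM_apply, reflectConj_toLp, SchwartzMap.toLp_fourier_eq,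
        SchwartzMap.toLp_fourier_eq]
      refine Lp.ext ?_
      filter_upwards [hBae ((𝓕 g).toLp 2), (𝓕 g).coeFn_toLp 2 volume,
        (𝓕 (schwartzReflectConj t g)).coeFn_toLp 2 volume] with v h1 h2 h3
      rw [h1, h2, h3, fourier_schwartzReflectConj]
  rw [key]
  exact hBae _

variable {H : ℝ → ℝ}

lemma coeFn_reflectConj_ofReal (hH : MemLp H 2 volume) (t : ℝ) :
    reflectConj t (MemLp.toLp (fun t => (H t : ℂ)) hH.ofReal) =ᵐ[volume]
      fun u => ((H (t - u) : ℝ) : ℂ) := by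
  refine (coeFn_reflectConj _ _).trans ?_
  filter_upwards [(volume.measurePreserving_sub_left t).quasiMeasurePreserving.ae_eq_comp
    (MemLp.coeFn_toLp (hH.ofReal (K := ℂ)))] with u hu
  simp only [Function.comp_apply] at hu
  erw [hu]
  exact Complex.conj_ofReal _

lemma coeFn_reflectConj_reflectConj_ofReal (hH : MemLp H 2 volume) (t : ℝ) :
    reflectConj 0 (reflectConj t (MemLp.toLp (fun t => (H t : ℂ)) hH.ofReal)) =ᵐ[volume]
      fun u => ((H (t + u) : ℝ) : ℂ) := by
  refine (coeFn_reflectConj _ _).trans ?_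
  filter_upwards [(volume.measurePreserving_sub_left 0).quasiMeasurePreserving.ae_eq_comp
    (coeFn_reflectConj_ofReal hH t)] with u hu
  simp only [Function.comp_apply] at hu
  rw [hu, Complex.conj_ofReal]
  simp

lemma memLp_sub_left (hH : MemLp H 2 volume) (t : ℝ) : MemLp (fun u => H (t - u)) 2 volume :=
  hH.comp_measurePreserving (volume.measurePreserving_sub_left t)

lemma memLp_add_left (hH : MemLp H 2 volume) (t : ℝ) : MemLp (fun u => H (t + u)) 2 volume :=
  hH.comp_measurePreserving (measurePreserving_add_left volume t)

/-- The limiting covariance in the time domain. -/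
lemma limitCov_eq (hH : MemLp H 2 volume) (s t : ℝ) : limitCov H hH s t =
    (((∫ u, H (s - u) * H (t - u)) + ∫ u, H (s - u) * H (t + u) : ℝ) : ℂ) := by
  set h : Lp ℂ 2 (volume : Measure ℝ) := MemLp.toLp (fun t => (H t : ℂ)) hH.ofReal with hh
  set G : ℝ → ℂ := ⇑(𝓕 h : Lp ℂ 2 (volume : Measure ℝ)) with hG
  set A : Lp ℂ 2 (volume : Measure ℝ) := reflectConj s h
  set B : Lp ℂ 2 (volume : Measure ℝ) := reflectConj t h
  set D : Lp ℂ 2 (volume : Measure ℝ) := reflectConj 0 B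
  set K₁ : ℝ → ℂ := fun v => Complex.exp (((2 * Real.pi * (s - t) * v : ℝ) : ℂ) * Complex.I) *
    ((‖G v‖ ^ 2 : ℝ) : ℂ) with hK₁
  set K₂ : ℝ → ℂ := fun v => Complex.exp (((2 * Real.pi * (s + t) * v : ℝ) : ℂ) * Complex.I) *
    (G v) ^ 2 with hK₂
  have e1 : (fun v => inner ℂ ((𝓕 A : Lp ℂ 2 (volume : Measure ℝ)) v)
      ((𝓕 B : Lp ℂ 2 (volume : Measure ℝ)) v)) =ᵐ[volume] K₁ := by
    filter_upwards [fourier_reflectConj s h, fourier_reflectConj t h] with v h1 h2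
    rw [h1, h2, hK₁, RCLike.inner_apply]
    simp only [map_mul, ← Complex.exp_conj, Complex.conj_ofReal, Complex.conj_I, Complex.conj_conj]
    rw [Complex.ofReal_pow, ← Complex.mul_conj', mul_mul_mul_comm, ← Complex.exp_add, mul_comm (conj _)]
    congr 2
    push_cast
    ring
  have e2 : (fun v => inner ℂ ((𝓕 A : Lp ℂ 2 (volume : Measure ℝ)) v)
      ((𝓕 D : Lp ℂ 2 (volume : Measure ℝ)) v)) =ᵐ[volume] K₂ := by
    filter_upwards [fourier_reflectConj s h, fourier_reflectConj t h, fourier_reflectConj 0 B]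
      with v h1 h2 h3
    rw [h3, h1, h2, hK₂, RCLike.inner_apply]
    simp only [map_mul, ← Complex.exp_conj, Complex.conj_ofReal, Complex.conj_I, Complex.conj_conj,
      mul_zero, zero_mul, neg_zero, Complex.ofReal_zero, Complex.exp_zero, one_mul]
    rw [mul_mul_mul_comm, ← Complex.exp_add, sq]
    congr 2
    push_cast
    ring
  have i1 : Integrable K₁ := (L2.integrable_inner _ _).congr e1
  have i2 : Integrable K₂ := (L2.integrable_inner _ _).congr e2
  have v1 : ∫ v, K₁ v = ((∫ u, H (s - u) * H (t - u) : ℝ) : ℂ) := by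
    rw [← integral_congr_ae e1, ← L2.inner_def, Lp.inner_fourier_eq, L2.inner_def,
      ← integral_complex_ofReal]
    refine integral_congr_ae ?_
    filter_upwards [coeFn_reflectConj_ofReal hH s, coeFn_reflectConj_ofReal hH t] with u h1 h2
    rw [h1, h2, RCLike.inner_apply]
    simp [mul_comm]
  have v2 : ∫ v, K₂ v = ((∫ u, H (s - u) * H (t + u) : ℝ) : ℂ) := by
    rw [← integral_congr_ae e2, ← L2.inner_def, Lp.inner_fourier_eq, L2.inner_def,
      ← integral_complex_ofReal]
    refine integral_congr_ae ?_
    filter_upwards [coeFn_reflectConj_ofReal hH s, coeFn_reflectConj_reflectConj_ofReal hH t]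
      with u h1 h2
    rw [h1, h2, RCLike.inner_apply]
    simp [mul_comm]
  -- The substitution `l = 2π v` has Jacobian `2π`, which cancels the prefactor.
  have scale : limitCov H hH s t =
      (1 / (2 * (Real.pi : ℂ))) * ∫ l : ℝ, (K₁ + K₂) (l / (2 * Real.pi)) := by
    unfold limitCov plancherel
    congr 1
    refine integral_congr_ae (ae_of_all _ fun l => ?_)
    have hpi : (Real.pi : ℂ) ≠ 0 := by exact_mod_cast Real.pi_ne_zero
    simp only [Pi.add_apply, hK₁, hK₂]
    congr 3
    · push_cast
      field_simp
    · push_cast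
      field_simp
  have hpi : (Real.pi : ℂ) ≠ 0 := by exact_mod_cast Real.pi_ne_zero
  rw [scale, Measure.integral_comp_div, abs_of_pos (by positivity)]
  simp only [Pi.add_apply]
  rw [integral_add i1 i2, v1, v2, Complex.real_smul]
  push_cast
  field_simp

lemma autoconv_eq (t : ℝ) : autoconv H t = ∫ u, H (t - u) * H (t + u) := by
  unfold autoconv
  rw [← integral_add_left_eq_self _ t]
  refine integral_congr_ae (ae_of_all _ fun u => ?_)
  simp only
  ring_nf

end Plancherel

/-! ### Comparison of Gaussian vectors with ordered covariances -/

section GaussianVectors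

variable {ι : Type*} [Fintype ι]

lemma integral_sum_mul_sum {α : Type*} [MeasurableSpace α] {μ : Measure α} {f g : ι → α → ℝ}
    (hf : ∀ i, MemLp (f i) 2 μ) (hg : ∀ i, MemLp (g i) 2 μ) (c : ι → ℝ) :
    ∫ x, (∑ i, c i * f i x) * (∑ j, c j * g j x) ∂μ =
      c ⬝ᵥ (Matrix.of fun i j => ∫ x, f i x * g j x ∂μ) *ᵥ c := by
  have hi : ∀ i j, Integrable (fun x => c i * c j * (f i x * g j x)) μ := fun i j =>
    ((hf i).integrable_mul (hg j)).const_mul _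
  have e : ∀ x, (∑ i, c i * f i x) * (∑ j, c j * g j x) =
      ∑ i, ∑ j, c i * c j * (f i x * g j x) := fun x => by
    rw [Finset.sum_mul_sum]
    exact Finset.sum_congr rfl fun i _ => Finset.sum_congr rfl fun j _ => by ring
  simp_rw [e]
  rw [integral_finsetSum _ fun i _ => integrable_finsetSum _ fun j _ => hi i j]
  simp only [dotProduct, Matrix.mulVec, Matrix.of_apply]
  refine Finset.sum_congr rfl fun i _ => ?_
  rw [integral_finsetSum _ fun j _ => hi i j, Finset.mul_sum]
  refine Finset.sum_congr rfl fun j _ => ?_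
  rw [integral_const_mul]
  ring

variable [DecidableEq ι] {S D : Matrix ι ι ℝ}

lemma map_neg_multivariateGaussian (hS : S.PosSemidef) :
    (multivariateGaussian 0 S).map (fun x => -x) = multivariateGaussian 0 S := by
  have : IsProbabilityMeasure ((multivariateGaussian 0 S).map (fun x => -x)) :=
    Measure.isProbabilityMeasure_map (by fun_prop)
  refine Measure.ext_of_charFun (funext fun t => ?_)
  have h := charFun_map_smul (μ := multivariateGaussian 0 S) (-1) t
  simp only [neg_smul, one_smul] at h
  rw [h, charFun_multivariateGaussian hS, charFun_multivariateGaussian hS]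
  simp [Matrix.mulVec_neg]

lemma multivariateGaussian_conv (hS : S.PosSemidef) (hD : D.PosSemidef) :
    multivariateGaussian 0 D ∗ multivariateGaussian 0 S = multivariateGaussian 0 (S + D) := by
  refine Measure.ext_of_charFun (funext fun t => ?_)
  rw [charFun_conv, charFun_multivariateGaussian hS, charFun_multivariateGaussian hD,
    charFun_multivariateGaussian (hS.add hD), ← Complex.exp_add]
  congr 1
  simp [Matrix.add_mulVec, dotProduct_add]
  ring

/-- Gaussian measures of symmetric convex sets decrease when the covariance increases. -/
lemma multivariateGaussian_add_le (hS : S.PosSemidef) (hD : D.PosSemidef)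
    {C : Set (EuclideanSpace ℝ ι)} (hC : MeasurableSet C) (hconv : Convex ℝ C)
    (hsymm : ∀ x ∈ C, -x ∈ C) : multivariateGaussian 0 (S + D) C ≤ multivariateGaussian 0 S C := by
  rw [← multivariateGaussian_conv hS hD]
  exact (prekopaLeindler_multivariateGaussian S).conv_le (map_neg_multivariateGaussian hS) hC hconv
    hsymm

variable {Ω : Type*} [MeasurableSpace Ω]

/-- Cramér-Wold: the characteristic functions at 1 of all linear combinations determine the law of
the vector. -/
lemma map_toLp_eq_multivariateGaussian {P : Measure Ω} [IsProbabilityMeasure P] {X : ι → Ω → ℝ}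
    (hX : ∀ i, AEMeasurable (X i) P) (hS : S.PosSemidef)
    (h : ∀ c : ι → ℝ, ∫ ω, Complex.exp (((∑ i, c i * X i ω : ℝ) : ℂ) * Complex.I) ∂P =
      Complex.exp (-((c ⬝ᵥ S *ᵥ c : ℝ) : ℂ) / 2)) :
    P.map (fun ω => WithLp.toLp 2 fun i => X i ω) = multivariateGaussian 0 S := by
  have hm : AEMeasurable (fun ω => WithLp.toLp 2 fun i => X i ω) P :=
    (by fun_prop : Measurable (WithLp.toLp 2 : (ι → ℝ) → EuclideanSpace ℝ ι)).comp_aemeasurable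
      (aemeasurable_pi_lambda _ hX)
  have : IsProbabilityMeasure (P.map fun ω => WithLp.toLp 2 fun i => X i ω) :=
    Measure.isProbabilityMeasure_map hm
  refine Measure.ext_of_charFun (funext fun t => ?_)
  rw [charFun_apply, integral_map hm (by fun_prop), charFun_multivariateGaussian hS]
  have := h t
  simp only [PiLp.inner_apply, RCLike.inner_apply, conj_trivial, inner_zero_right, Complex.ofReal_zero,
    zero_mul, zero_sub]
  rw [this, neg_div]

variable {Ω' : Type*} [MeasurableSpace Ω']

/-- The event for `Z` is the exit from a symmetric convex cube, which is likelier under the larger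
covariance `S + D`. An exit is one-sided in `y` or in `-y`, and these have equal probability, whence
the factor 2. -/
lemma measure_exists_abs_gt_le {P : Measure Ω} [IsProbabilityMeasure P] {P' : Measure Ω'}
    [IsProbabilityMeasure P'] {X : ι → Ω → ℝ} {Z : ι → Ω' → ℝ}
    (hXm : ∀ i, AEMeasurable (X i) P) (hZm : ∀ i, AEMeasurable (Z i) P')
    (hS : S.PosSemidef) (hD : D.PosSemidef)
    (hX : P.map (fun ω => WithLp.toLp 2 fun i => X i ω) = multivariateGaussian 0 (S + D))
    (hZ : P'.map (fun ω => WithLp.toLp 2 fun i => Z i ω) = multivariateGaussian 0 S) (x : ℝ) :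
    P' {ω | ∃ i, x < |Z i ω|} ≤ 2 * P {ω | ∃ i, x < X i ω} := by
  have hXm' : AEMeasurable (fun ω => WithLp.toLp 2 fun i => X i ω) P :=
    (by fun_prop : Measurable (WithLp.toLp 2 : (ι → ℝ) → EuclideanSpace ℝ ι)).comp_aemeasurable
      (aemeasurable_pi_lambda _ hXm)
  have hZm' : AEMeasurable (fun ω => WithLp.toLp 2 fun i => Z i ω) P' :=
    (by fun_prop : Measurable (WithLp.toLp 2 : (ι → ℝ) → EuclideanSpace ℝ ι)).comp_aemeasurable
      (aemeasurable_pi_lambda _ hZm)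
  set C : Set (EuclideanSpace ℝ ι) := {y | ∀ i, |y i| ≤ x} with hCdef
  set U : Set (EuclideanSpace ℝ ι) := {y | ∃ i, x < y i} with hUdef
  have hC : MeasurableSet C := by
    rw [hCdef, ofPred_forall]
    exact MeasurableSet.iInter fun i => measurableSet_le (by fun_prop) measurable_const
  have hU : MeasurableSet U := by
    rw [hUdef, ofPred_exists]
    exact MeasurableSet.iUnion fun i => measurableSet_lt measurable_const (by fun_prop)
  have hconv : Convex ℝ C := by
    intro y hy z hz p q hp hq hpq i
    have h1 := abs_le.1 (hy i)
    have h2 := abs_le.1 (hz i)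
    simp only [PiLp.add_apply, PiLp.smul_apply, smul_eq_mul]
    rw [abs_le]
    constructor <;> nlinarith
  have hsymm : ∀ y ∈ C, -y ∈ C := fun y hy i => by simpa using hy i
  have hU' : MeasurableSet ((fun y => -y) ⁻¹' U) := hU.preimage measurable_neg
  calc P' {ω | ∃ i, x < |Z i ω|}
      = multivariateGaussian 0 S Cᶜ := by
        rw [← hZ, Measure.map_apply_of_aemeasurable hZm' hC.compl]
        congr 1
        ext ω
        simp [hCdef]
    _ ≤ multivariateGaussian 0 (S + D) Cᶜ := by
        rw [prob_compl_eq_one_sub hC, prob_compl_eq_one_sub hC]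
        exact tsub_le_tsub_left (multivariateGaussian_add_le hS hD hC hconv hsymm) _
    _ ≤ multivariateGaussian 0 (S + D) (U ∪ (fun y => -y) ⁻¹' U) := by
        refine measure_mono fun y hy => ?_
        simp only [hCdef, mem_compl_iff, mem_ofPred_eq, not_forall, not_le] at hy
        obtain ⟨i, hi⟩ := hy
        rcases lt_abs.1 hi with h | h
        · exact Or.inl ⟨i, h⟩
        · exact Or.inr ⟨i, h⟩
    _ ≤ multivariateGaussian 0 (S + D) U + multivariateGaussian 0 (S + D) ((fun y => -y) ⁻¹' U) :=
        measure_union_le _ _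
    _ = 2 * multivariateGaussian 0 (S + D) U := by
        rw [← Measure.map_apply measurable_neg hU, map_neg_multivariateGaussian (hS.add hD),
          two_mul]
    _ = 2 * P {ω | ∃ i, x < X i ω} := by
        rw [← hX, Measure.map_apply_of_aemeasurable hXm' hU]
        rfl

end GaussianVectors

/-! ### Finite-dimensional laws of the two processes -/

section Processes

variable {Ω Ω' : Type*} [MeasurableSpace Ω] [MeasurableSpace Ω'] {P : Measure Ω} {P' : Measure Ω'}
  {H : ℝ → ℝ}

lemma integral_sub_mul_add_comm (H : ℝ → ℝ) (s t : ℝ) :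
    ∫ u, H (s - u) * H (t + u) = ∫ u, H (t - u) * H (s + u) := by
  rw [← integral_neg_eq_self]
  refine integral_congr_ae (ae_of_all _ fun u => ?_)
  simp only [sub_neg_eq_add]
  rw [mul_comm, ← sub_eq_add_neg]

/-- The covariance matrix of the limiting process. -/
def covMatrix {ι : Type*} (H : ℝ → ℝ) (τ : ι → ℝ) : Matrix ι ι ℝ :=
  Matrix.of (fun i j => ∫ u, H (τ i - u) * H (τ j - u)) +
    Matrix.of fun i j => ∫ u, H (τ i - u) * H (τ j + u)

/-- The excess of the covariance matrix of the comparison process over `covMatrix`. -/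
def excessMatrix {ι : Type*} (H : ℝ → ℝ) (τ : ι → ℝ) (β : ι → ℝ) : Matrix ι ι ℝ :=
  Matrix.of (fun i j => ∫ u, H (τ i - u) * H (τ j - u)) -
    Matrix.of (fun i j => ∫ u, H (τ i - u) * H (τ j + u)) + Matrix.vecMulVec β β

variable {ι : Type*} [Fintype ι]

/-- Integrate `2 |F(u) F(-u)| ≤ F(u)² + F(-u)²`; reflection preserves the integral. The two signs
give the positivity of `R + Q` and of `R - Q`. -/
lemma integral_mul_neg_le {F : ℝ → ℝ} (hF : MemLp F 2 volume) :
    |∫ u, F u * F (-u)| ≤ ∫ u, F u * F u := by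
  have hF' : MemLp (fun u => F (-u)) 2 volume :=
    hF.comp_measurePreserving (Measure.measurePreserving_neg volume)
  have e : ∫ u, F (-u) * F (-u) = ∫ u, F u * F u := integral_neg_eq_self (fun u => F u * F u) volume
  have i1 := hF.integrable_mul hF
  have i2 := hF'.integrable_mul hF'
  have i3 := hF.integrable_mul hF'
  have h1 : ∫ u, F u * F u + F (-u) * F (-u) = 2 * ∫ u, F u * F u := by
    rw [integral_add (f := fun u => F u * F u) (g := fun u => F (-u) * F (-u)) i1 i2, e, two_mul]
  have h2 : ∫ u, 2 * (F u * F (-u)) ≤ ∫ u, F u * F u + F (-u) * F (-u) :=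
    integral_mono (i3.const_mul 2) (i1.add i2) fun u => by
      simp only; nlinarith [sq_nonneg (F u - F (-u))]
  have h3 : ∫ u, -2 * (F u * F (-u)) ≤ ∫ u, F u * F u + F (-u) * F (-u) :=
    integral_mono (i3.const_mul (-2)) (i1.add i2) fun u => by
      simp only; nlinarith [sq_nonneg (F u + F (-u))]
  rw [integral_const_mul] at h2 h3
  rw [abs_le]
  constructor <;> linarith

lemma dotProduct_covMatrix (hH : MemLp H 2 volume) (τ c : ι → ℝ) :
    c ⬝ᵥ covMatrix H τ *ᵥ c =
      (∫ u, (∑ i, c i * H (τ i - u)) * (∑ i, c i * H (τ i - u))) +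
        ∫ u, (∑ i, c i * H (τ i - u)) * (∑ i, c i * H (τ i + u)) := by
  rw [integral_sum_mul_sum (fun i => memLp_sub_left hH _) (fun i => memLp_sub_left hH _),
    integral_sum_mul_sum (fun i => memLp_sub_left hH _) (fun i => memLp_add_left hH _), covMatrix,
    Matrix.add_mulVec, dotProduct_add]

lemma dotProduct_excessMatrix (hH : MemLp H 2 volume) (τ β c : ι → ℝ) :
    c ⬝ᵥ excessMatrix H τ β *ᵥ c =
      (∫ u, (∑ i, c i * H (τ i - u)) * (∑ i, c i * H (τ i - u))) -
        (∫ u, (∑ i, c i * H (τ i - u)) * (∑ i, c i * H (τ i + u))) + (∑ i, c i * β i) ^ 2 := by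
  rw [integral_sum_mul_sum (fun i => memLp_sub_left hH _) (fun i => memLp_sub_left hH _),
    integral_sum_mul_sum (fun i => memLp_sub_left hH _) (fun i => memLp_add_left hH _),
    excessMatrix, Matrix.add_mulVec, dotProduct_add, Matrix.sub_mulVec, dotProduct_sub,
    Matrix.vecMulVec_mulVec]
  congr 1
  simp [dotProduct, sq, Finset.mul_sum, mul_comm, mul_left_comm]

lemma abs_integral_sum_mul_le (hH : MemLp H 2 volume) (τ c : ι → ℝ) :
    |∫ u, (∑ i, c i * H (τ i - u)) * (∑ i, c i * H (τ i + u))| ≤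
      ∫ u, (∑ i, c i * H (τ i - u)) * (∑ i, c i * H (τ i - u)) := by
  have := integral_mul_neg_le (F := fun u => ∑ i, c i * H (τ i - u))
    (memLp_finsetSum _ fun i _ => (memLp_sub_left hH _).const_mul _)
  simpa using this

lemma posSemidef_covMatrix (hH : MemLp H 2 volume) (τ : ι → ℝ) : (covMatrix H τ).PosSemidef := by
  refine .of_dotProduct_mulVec_nonneg ?_ fun c => ?_
  · ext i j
    simp only [covMatrix, Matrix.conjTranspose_apply, Matrix.add_apply, Matrix.of_apply,
      star_trivial]
    rw [integral_sub_mul_add_comm]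
    simp_rw [mul_comm (H (τ j - _)) (H (τ i - _))]
  · rw [star_trivial, dotProduct_covMatrix hH]
    have := abs_le.1 (abs_integral_sum_mul_le hH τ c)
    linarith

lemma posSemidef_excessMatrix (hH : MemLp H 2 volume) (τ β : ι → ℝ) :
    (excessMatrix H τ β).PosSemidef := by
  refine .of_dotProduct_mulVec_nonneg ?_ fun c => ?_
  · ext i j
    simp only [excessMatrix, Matrix.conjTranspose_apply, Matrix.add_apply, Matrix.sub_apply,
      Matrix.of_apply, star_trivial, Matrix.vecMulVec_apply]
    rw [integral_sub_mul_add_comm, mul_comm (β j)]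
    simp_rw [mul_comm (H (τ j - _)) (H (τ i - _))]
  · rw [star_trivial, dotProduct_excessMatrix hH]
    have := abs_le.1 (abs_integral_sum_mul_le hH τ c)
    nlinarith [sq_nonneg (∑ i, c i * β i)]

variable [DecidableEq ι]

lemma map_limit_eq_multivariateGaussian [IsProbabilityMeasure P'] (hH : MemLp H 2 volume)
    {Z : ℝ → Ω' → ℝ} (hZ : IsGaussianProcess Z P') (hZmean : ∀ t, ∫ ω, Z t ω ∂P' = 0)
    (hZcov : ∀ s t, ((∫ ω, Z s ω * Z t ω ∂P' : ℝ) : ℂ) = limitCov H hH s t) (τ : ι → ℝ) :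
    P'.map (fun ω => WithLp.toLp 2 fun i => Z (τ i) ω) =
      multivariateGaussian 0 (covMatrix H τ) := by
  have hm : ∀ t, MemLp (Z t) 2 P' := fun t => (hZ.hasGaussianLaw_eval t).memLp_two
  refine map_toLp_eq_multivariateGaussian (fun i => hZ.aemeasurable _) (posSemidef_covMatrix hH τ)
    fun c => ?_
  have hG : HasGaussianLaw (fun ω => ∑ i, c i * Z (τ i) ω) P' :=
    ((hZ.comp_right τ).smul c).hasGaussianLaw_fun_sum (I := Finset.univ)
  rw [HasGaussianLaw.integral_cexp hG ?_]
  · simp_rw [sq]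
    rw [integral_sum_mul_sum (fun i => hm _) (fun i => hm _)]
    have hM : (Matrix.of fun i j => ∫ ω, Z (τ i) ω * Z (τ j) ω ∂P') = covMatrix H τ := by
      ext i j
      have h := hZcov (τ i) (τ j)
      rw [limitCov_eq hH, Complex.ofReal_inj] at h
      simpa [covMatrix] using h
    rw [hM]
  · have hi : ∀ i, Integrable (fun ω => c i * Z (τ i) ω) P' := fun i =>
      ((hm _).integrable one_le_two).const_mul _
    rw [integral_finsetSum _ fun i _ => hi i]
    simp [integral_const_mul, hZmean]

lemma integral_cexp_gaussian_mul [IsProbabilityMeasure P] {ξ : Ω → ℝ}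
    (hξ : HasLaw ξ (gaussianReal 0 1) P) (β : ℝ) :
    ∫ ω, Complex.exp (((β * ξ ω : ℝ) : ℂ) * Complex.I) ∂P =
      Complex.exp (-((β ^ 2 : ℝ) : ℂ) / 2) := by
  have h := charFun_gaussianReal (μ := 0) (v := 1) β
  rw [← hξ.map_eq, charFun_apply_real, integral_map hξ.aemeasurable (by fun_prop)] at h
  simp only [Complex.ofReal_mul]
  rw [h]
  congr 1
  simp
  ring

/-- Independence factors the characteristic function into those of `ξ` and of one Wiener integral,
with exponents from `ββᵀ` and `2R`. The covariance is written as `(R + Q) + (R - Q + ββᵀ)` to fit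
the comparison. -/
lemma map_comparison_eq_multivariateGaussian [IsProbabilityMeasure P] (hH : MemLp H 2 volume)
    {W : ℝ → Ω → ℝ} (hW : IsWienerProcess W P) {Y : ℝ → Ω → ℝ}
    (hY : ∀ t, IsWienerIntegral W P (fun s => H (t - s)) (Y t)) {ξ : Ω → ℝ}
    (hξ : HasLaw ξ (gaussianReal 0 1) P) (hindep : IndepFun ξ (fun ω t => Y t ω) P)
    (τ β : ι → ℝ) :
    P.map (fun ω => WithLp.toLp 2 fun i => √2 * Y (τ i) ω + ξ ω * β i) =
      multivariateGaussian 0 (covMatrix H τ + excessMatrix H τ β) := by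
  have hYm : ∀ t, AEMeasurable (Y t) P := fun t => (hY t).2.1.1.aemeasurable
  refine map_toLp_eq_multivariateGaussian
    (fun i => ((hYm _).const_mul _).add (hξ.aemeasurable.mul_const _))
    ((posSemidef_covMatrix hH τ).add (posSemidef_excessMatrix hH τ β)) fun c => ?_
  have hI := IsWienerIntegral.sum hW Finset.univ (fun i => hY (τ i)) fun i => √2 * c i
  have hmul : ∀ ω, Complex.exp (((∑ i, c i * (√2 * Y (τ i) ω + ξ ω * β i) : ℝ) : ℂ) * Complex.I) =
      Complex.exp ((((∑ i, c i * β i) * ξ ω : ℝ) : ℂ) * Complex.I) *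
        Complex.exp (((∑ i, √2 * c i * Y (τ i) ω : ℝ) : ℂ) * Complex.I) := by
    intro ω
    rw [← Complex.exp_add, ← add_mul, ← Complex.ofReal_add]
    congr 3
    rw [Finset.sum_mul, ← Finset.sum_add_distrib]
    exact Finset.sum_congr rfl fun i _ => by ring
  simp_rw [hmul]
  have hind := hindep.comp
    (φ := fun x => Complex.exp ((((∑ i, c i * β i) * x : ℝ) : ℂ) * Complex.I))
    (ψ := fun y : ℝ → ℝ => Complex.exp (((∑ i, √2 * c i * y (τ i) : ℝ) : ℂ) * Complex.I))
    (by fun_prop) (by fun_prop)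
  have hexp : ∀ {U : Ω → ℝ}, AEMeasurable U P →
      AEStronglyMeasurable (fun ω => Complex.exp ((U ω : ℂ) * Complex.I)) P := fun hU =>
    ((by fun_prop : Measurable fun x : ℝ => Complex.exp ((x : ℂ) * Complex.I)).comp_aemeasurable
      hU).aestronglyMeasurable
  refine (hind.integral_fun_mul_eq_mul_integral (hexp (hξ.aemeasurable.const_mul _))
    (hexp hI.2.1.1.aemeasurable)).trans ?_
  simp only [Function.comp_apply]
  rw [integral_cexp_gaussian_mul hξ, hI.integral_cexp hW, ← Complex.exp_add]
  congr 1
  have e : ∫ s, (∑ i, √2 * c i * H (τ i - s)) ^ 2 =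
      2 * ∫ u, (∑ i, c i * H (τ i - u)) * (∑ i, c i * H (τ i - u)) := by
    rw [← integral_const_mul]
    refine integral_congr_ae (ae_of_all _ fun s => ?_)
    simp only [mul_assoc, ← Finset.mul_sum]
    rw [mul_pow, Real.sq_sqrt zero_le_two, sq]
  rw [e, Matrix.add_mulVec, dotProduct_add, dotProduct_covMatrix hH, dotProduct_excessMatrix hH]
  push_cast
  ring

end Processes

/-! ### The correction function, and reduction to countably many times -/

section Correction

variable {Ω Ω' : Type*} [MeasurableSpace Ω] [MeasurableSpace Ω'] {P : Measure Ω} {P' : Measure Ω'}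
  {H : ℝ → ℝ}

lemma integral_sub_sq (H : ℝ → ℝ) (t : ℝ) : ∫ u, H (t - u) * H (t - u) = ∫ u, H u ^ 2 := by
  simp_rw [← sq]
  exact integral_sub_left_eq_self (fun u => H u ^ 2) volume t

lemma abs_autoconv_le (hH : MemLp H 2 volume) (t : ℝ) : |autoconv H t| ≤ ∫ u, H u ^ 2 := by
  rw [autoconv_eq, ← integral_sub_sq H t]
  simpa using integral_mul_neg_le (memLp_sub_left hH t)

lemma varGap_eq (hH : MemLp H 2 volume) {W : ℝ → Ω → ℝ} (hW : IsWienerProcess W P)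
    {Y : ℝ → Ω → ℝ} (hY : ∀ t, IsWienerIntegral W P (fun s => H (t - s)) (Y t)) {Z : ℝ → Ω' → ℝ}
    (hZcov : ∀ s t, ((∫ ω, Z s ω * Z t ω ∂P' : ℝ) : ℂ) = limitCov H hH s t) (t : ℝ) :
    varGap Y P Z P' t = (∫ u, H u ^ 2) - autoconv H t := by
  have h := hZcov t t
  rw [limitCov_eq hH, Complex.ofReal_inj, ← autoconv_eq, integral_sub_sq] at h
  unfold varGap
  simp_rw [mul_pow, Real.sq_sqrt zero_le_two]
  rw [integral_const_mul, (hY t).integral_sq hW]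
  simp_rw [sq (Z t _)]
  rw [h]
  have := integral_sub_sq H t
  simp_rw [← sq] at this
  rw [this]
  ring

/-- Since `|autoconv H| ≤ ∫ H²`, the variance gap is nonnegative and the maximum with 0 changes
nothing; the supremum of `∫ H² - autoconv H` is then `∫ H²` minus the infimum. -/
lemma corr_sq_eq (hH : MemLp H 2 volume) {W : ℝ → Ω → ℝ} (hW : IsWienerProcess W P)
    {Y : ℝ → Ω → ℝ} (hY : ∀ t, IsWienerIntegral W P (fun s => H (t - s)) (Y t)) {Z : ℝ → Ω' → ℝ}
    (hZcov : ∀ s t, ((∫ ω, Z s ω * Z t ω ∂P' : ℝ) : ℂ) = limitCov H hH s t) {a b t : ℝ}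
    (ht : t ∈ Icc a b) :
    corr Y P Z P' a b t ^ 2 = autoconv H t - sInf (autoconv H '' Icc a b) := by
  set r := ∫ u, H u ^ 2 with hr
  have hgap := varGap_eq hH hW hY hZcov
  have hq := abs_autoconv_le hH
  have hmax : ∀ u, max 0 (varGap Y P Z P' u) = r - autoconv H u := fun u => by
    rw [hgap, max_eq_right]
    linarith [(abs_le.1 (hq u)).2]
  have hne : (autoconv H '' Icc a b).Nonempty := ⟨_, t, ht, rfl⟩
  have hbdd : BddBelow (autoconv H '' Icc a b) := by
    refine ⟨-r, ?_⟩
    rintro _ ⟨u, -, rfl⟩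
    exact (abs_le.1 (hq u)).1
  have hsup : sSup ((fun u => max 0 (varGap Y P Z P' u)) '' Icc a b) =
      r - sInf (autoconv H '' Icc a b) := by
    simp_rw [hmax]
    refine IsLUB.csSup_eq ⟨?_, ?_⟩ ⟨_, t, ht, rfl⟩
    · rintro _ ⟨u, hu, rfl⟩
      have := csInf_le hbdd ⟨u, hu, rfl⟩
      simp only
      linarith
    · intro m hm
      have : r - m ≤ sInf (autoconv H '' Icc a b) := by
        refine le_csInf hne ?_
        rintro _ ⟨u, hu, rfl⟩
        have := hm ⟨u, hu, rfl⟩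
        simp only at this
        linarith
      linarith
  unfold corr
  rw [hsup, hgap, Real.sq_sqrt]
  · ring
  · have := csInf_le hbdd ⟨t, ht, rfl⟩
    linarith

/-- A separable process exceeds a level on an interval only if it does on a countable subset. -/
lemma IsSeparableProcess.exists_countable {Z : ℝ → Ω' → ℝ} (hZ : IsSeparableProcess Z P') {a b : ℝ}
    (hab : a ≤ b) (x : ℝ) : ∃ D : Set ℝ, D.Countable ∧ D ⊆ Icc a b ∧
      ∀ᵐ ω ∂P', (∃ t ∈ Icc a b, x < |Z t ω|) → ∃ t ∈ D, x < |Z t ω| := by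
  obtain ⟨D, hD, h⟩ := hZ
  -- Separability controls only open sets, here `Ioo a b`, so the endpoints are adjoined by hand.
  refine ⟨insert a (insert b (D ∩ Ioo a b)), ((hD.mono inter_subset_left).insert b).insert a, ?_, ?_⟩
  · rintro t (rfl | rfl | ⟨-, ht⟩)
    · exact ⟨le_rfl, hab⟩
    · exact ⟨hab, le_rfl⟩
    · exact Ioo_subset_Icc_self ht
  filter_upwards [h] with ω hω
  contrapose!
  intro hle t ht
  rcases eq_endpoints_or_mem_Ioo_of_mem_Icc ht with rfl | rfl | ht'
  · exact hle _ (by simp)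
  · exact hle _ (by simp)
  · exact hω (Ioo a b) {z | |z| ≤ x} isOpen_Ioo (isClosed_le continuous_abs continuous_const)
      (fun s hs => hle s (by simp [hs])) t ht'

end Correction

end CrossCorrelogram

end

/-! ### The theorem -/

theorem theorem2
    {Ω Ω' : Type*} [MeasurableSpace Ω] [MeasurableSpace Ω']
    (P : Measure Ω) [IsProbabilityMeasure P] (P' : Measure Ω') [IsProbabilityMeasure P']
    -- the impulse response function
    (H : ℝ → ℝ) (hH : MemLp H 2 volume)
    -- the input, and the output `Y(t) = ∫ H(t - s) dW(s)`
    (W : ℝ → Ω → ℝ) (hW : CrossCorrelogram.IsWienerProcess W P)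
    (Y : ℝ → Ω → ℝ)
    (hY : ∀ t, CrossCorrelogram.IsWienerIntegral W P (fun s => H (t - s)) (Y t))
    (hYcont : ∀ᵐ ω ∂P, Continuous fun t => Y t ω)
    -- the limiting Gaussian process
    (Z : ℝ → Ω' → ℝ) (hZ : IsGaussianProcess Z P')
    (hZsep : CrossCorrelogram.IsSeparableProcess Z P')
    (hZmean : ∀ t, ∫ ω, Z t ω ∂P' = 0)
    (hZcov : ∀ s t, ((∫ ω, Z s ω * Z t ω ∂P' : ℝ) : ℂ) = CrossCorrelogram.limitCov H hH s t)
    -- the standard Gaussian random variable, independent of the process `Y`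
    (ξ : Ω → ℝ) (hξ : HasLaw ξ (gaussianReal 0 1) P)
    (hindep : IndepFun ξ (fun ω t => Y t ω) P)
    (a b : ℝ) (hab : a ≤ b) :
    (∀ t ∈ Icc a b, CrossCorrelogram.corr Y P Z P' a b t ^ 2 =
      CrossCorrelogram.autoconv H t - sInf (CrossCorrelogram.autoconv H '' Icc a b)) ∧
    ∀ x : ℝ, 0 < x →
      P' {ω | (x : EReal) < CrossCorrelogram.supOn a b (fun t => |Z t ω|)} ≤
        2 * P {ω | (x : EReal) <
          CrossCorrelogram.supOn a b
            (fun t => √2 * Y t ω + ξ ω * CrossCorrelogram.corr Y P Z P' a b t)} := by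
  classical
  refine ⟨fun t ht => CrossCorrelogram.corr_sq_eq hH hW hY hZcov ht, fun x _ => ?_⟩
  simp only [CrossCorrelogram.supOn, lt_biSup_iff, EReal.coe_lt_coe_iff]
  set β := CrossCorrelogram.corr Y P Z P' a b
  obtain ⟨D, hD, hDsub, hae⟩ := hZsep.exists_countable hab x
  have hcount : Countable D := hD.to_subtype
  -- The countable set is exhausted by its finite subsets, a directed family, so the
  -- finite-dimensional bound passes to the union. For `Y`, exceedance at finitely many points of
  -- `[a, b]` already implies exceedance on `[a, b]`.
  calc P' {ω | ∃ t ∈ Icc a b, x < |Z t ω|}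
      ≤ P' (⋃ I : Finset D, {ω | ∃ i : I, x < |Z (i : D) ω|}) := by
        refine measure_mono_ae ?_
        filter_upwards [hae] with ω hω h
        obtain ⟨t, ht, hxt⟩ := hω h
        exact mem_iUnion.2 ⟨{⟨t, ht⟩}, ⟨⟨t, ht⟩, by simp⟩, hxt⟩
    _ = ⨆ I : Finset D, P' {ω | ∃ i : I, x < |Z (i : D) ω|} := by
        refine Directed.measure_iUnion (directed_of_isDirected_le fun I J hIJ => ?_)
        rintro ω ⟨i, hi⟩
        exact ⟨⟨i, hIJ i.2⟩, hi⟩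
    _ ≤ _ := by
        refine iSup_le fun I => ?_
        have hYm : ∀ t, AEMeasurable (Y t) P := fun t => (hY t).2.1.1.aemeasurable
        refine (CrossCorrelogram.measure_exists_abs_gt_le
          (X := fun (i : I) ω => √2 * Y (i : D) ω + ξ ω * β (i : D))
          (Z := fun (i : I) => Z (i : D))
          (fun i => ((hYm _).const_mul _).add (hξ.aemeasurable.mul_const _))
          (fun i => hZ.aemeasurable _) (CrossCorrelogram.posSemidef_covMatrix hH _)
          (CrossCorrelogram.posSemidef_excessMatrix hH _ _)
          (CrossCorrelogram.map_comparison_eq_multivariateGaussian hH hW hY hξ hindep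
            (fun i : I => ((i : D) : ℝ)) fun i => β (i : D))
          (CrossCorrelogram.map_limit_eq_multivariateGaussian hH hZ hZmean hZcov
            fun i : I => ((i : D) : ℝ)) x).trans ?_
        gcongr
        rintro ⟨i, hi⟩
        exact ⟨_, hDsub (i : D).2, hi⟩
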